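/- Let $S^1=\mathbb R/\mathbb Z$, identified with $[0,1]$ with its end points glued. Thompson's group $T$ is the group of homeomorphisms of $S^1$ that map dyadic points to dyadic points and are linear, with slope an integer power of $2$, on each interval of some partition of $S^1$ into finitely many intervals with dyadic end points; products are written from left to right, so $fg$ means first $f$, then $g$. Let $F=\{f\in T: f(0)=0\}$. Give the root of a full binary tree the interval $[0,1)$, and let every inner vertex pass the left half of its interval to its left child and the right half to its right child. A triple $(R,S,n)$ of two full binary trees with the same number $m$ of leaves and an integer $1\le n\le m$ represents the element of $T$ that maps the interval of the $i$-th leaf of $R$ linearly and increasingly onto the interval of the leaf of $S$ identified with it, where the first leaf of $R$ is identified with the $n$-th leaf of $S$ and the other leaves follow cyclically. The triple is reduced if no two carets, one of $R$ and one of $S$, both with two leaves as children, have their left leaves identified and their right leaves identified; each $f\in T$ has exactly one reduced triple. The Thompson graph of a full binary tree with leaves $l_1,\dots,l_m$ on a horizontal line has vertices $v_1,\dots,v_m$ on this line, with $v_1$ to the left of $l_1$ and $v_i$ between $l_{i-1}$ and $l_i$. For every left edge $e$ of the tree it has one edge, joining the two vertices that can be connected by a path above the line which passes through the tree only at $e$: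 if the leaves below $e$ are $l_i,\dots,l_{j-1}$, these are $v_i$ and $v_j$. The Thompson graph of $f\in T$ with reduced triple $(R,S,n)$ is obtained from the Thompson graphs of $R$ and $S$ by identifying their vertices in the same way as the leaves. Let $\vec T$ be the set of all $f\in T$ whose Thompson graph is bipartite, and let $\vec F=\vec T\cap F$. Let $x_0\in F$ be given by $x_0(t)=2t$ for $t\in[0,\frac14)$, $x_0(t)=t+\frac14$ for $t\in[\frac14,\frac12)$ and $x_0(t)=\frac t2+\frac12$ for $t\in[\frac12,1]$. For $n\ge 0$ let $x_{n+1}\in F$ be given by $x_{n+1}(t)=t$ for $t\in[0,\frac12]$ and $x_{n+1}(t)=\frac{x_n(2t-1)+1}{2}$ for $t\in(\frac12,1]$. Let $f_{1/2}\in T$ be the rotation $t\mapsto t+\frac12 \bmod 1$. Theorem. $\vec T$ is a subgroup of $T$, and $$\vec T=\langle \vec F,\,f_{1/2}\rangle=\langle x_0x_1,\;x_1x_2,\;x_2x_3,\;f_{1/2}\rangle .$$ -/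

import Mathlib

noncomputable section

namespace JonesThompson

/-! ### Thompson's group `T`

The unit circle is `UnitAddCircle = ℝ / ℤ`, that is, `[0,1]` with its end points identified. -/

/-- A dyadic real number: an integer multiple of an integer power of `2`. -/
def IsDyadic (x : ℝ) : Prop := ∃ (a k : ℤ), x = a * (2 : ℝ) ^ k

/-- On the arc `[u, v]` the circle map `f` is linear, its slope is an integer power of `2`, and it
sends dyadic points to dyadic points. -/
def IsDyadicLinearOn (f : UnitAddCircle → UnitAddCircle) (u v : ℝ) : Prop :=
  ∃ (k : ℤ) (b : ℝ), IsDyadic b ∧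
    ∀ s ∈ Set.Icc u v, f (s : UnitAddCircle) = (((2 : ℝ) ^ k * s + b : ℝ) : UnitAddCircle)

/-- `f` is piecewise dyadic linear: there are finitely many dyadic points such that `f` is dyadic
linear on each interval of the partition of the circle, cut open at `0`, which they define. -/
def IsPiecewiseDyadic (f : UnitAddCircle → UnitAddCircle) : Prop :=
  ∃ D : Finset ℝ, (∀ d ∈ D, IsDyadic d) ∧
    ∀ u v : ℝ, 0 ≤ u → u < v → v ≤ 1 → (∀ d ∈ D, d ∉ Set.Ioo u v) → IsDyadicLinearOn f u v

theorem IsDyadic.add {x y : ℝ} (hx : IsDyadic x) (hy : IsDyadic y) : IsDyadic (x + y) := by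
  obtain ⟨a, k, rfl⟩ := hx
  obtain ⟨b, l, rfl⟩ := hy
  rcases le_total k l with h | h
  · obtain ⟨n, rfl⟩ := Int.le.dest h
    refine ⟨a + b * 2 ^ n, k, ?_⟩
    rw [zpow_add₀ two_ne_zero]; push_cast; rw [zpow_natCast]; ring
  · obtain ⟨n, rfl⟩ := Int.le.dest h
    refine ⟨a * 2 ^ n + b, l, ?_⟩
    rw [zpow_add₀ two_ne_zero]; push_cast; rw [zpow_natCast]; ring

theorem IsDyadic.neg {x : ℝ} (hx : IsDyadic x) : IsDyadic (-x) := by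
  obtain ⟨a, k, rfl⟩ := hx
  exact ⟨-a, k, by push_cast; ring⟩

theorem IsDyadic.sub {x y : ℝ} (hx : IsDyadic x) (hy : IsDyadic y) : IsDyadic (x - y) := by
  rw [sub_eq_add_neg]; exact hx.add hy.neg

theorem isDyadic_int (n : ℤ) : IsDyadic n := ⟨n, 0, by simp⟩

theorem IsDyadic.zpow_mul {x : ℝ} (hx : IsDyadic x) (k : ℤ) : IsDyadic ((2 : ℝ) ^ k * x) := by
  obtain ⟨a, l, rfl⟩ := hx
  exact ⟨a, k + l, by rw [zpow_add₀ two_ne_zero]; ring⟩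

theorem coe_eq_coe_iff {x y : ℝ} :
    (x : UnitAddCircle) = (y : UnitAddCircle) ↔ ∃ n : ℤ, x = y + n := by
  rw [← sub_eq_zero, ← AddCircle.coe_sub, AddCircle.coe_eq_zero_iff]
  simp only [zsmul_eq_mul, mul_one]
  exact exists_congr fun n => ⟨fun h => by linarith, fun h => by linarith⟩

/-- The point of `[0,1)` which represents a point of the circle. -/
theorem exists_rep (x : UnitAddCircle) : ∃ s : ℝ, 0 ≤ s ∧ s < 1 ∧ (s : UnitAddCircle) = x := by
  obtain ⟨s, rfl⟩ := QuotientAddGroup.mk_surjective x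
  exact ⟨Int.fract s, Int.fract_nonneg s, Int.fract_lt_one s,
    coe_eq_coe_iff.2 ⟨-⌊s⌋, by rw [Int.fract]; push_cast; ring⟩⟩

theorem isPiecewiseDyadic_id : IsPiecewiseDyadic id :=
  ⟨∅, by simp, fun u v _ _ _ _ => ⟨0, 0, by simpa using isDyadic_int 0, fun s _ => by simp⟩⟩

/-- A finite set of reals leaves free some interval to the right of a given point. -/
theorem exists_next (D : Finset ℝ) {s : ℝ} (hs : s < 1) :
    ∃ q, s < q ∧ q ≤ 1 ∧ (q = 1 ∨ q ∈ D) ∧ ∀ d ∈ D, d ∉ Set.Ioo s q := by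
  classical
  let E := (insert 1 D).filter (fun d => s < d)
  have hE : E.Nonempty := ⟨1, by simp [E, hs]⟩
  have hm := E.min'_mem hE
  have hle : ∀ d ∈ E, E.min' hE ≤ d := fun d hd => E.min'_le d hd
  refine ⟨E.min' hE, (Finset.mem_filter.1 hm).2, hle 1 (by simp [E, hs]),
    Finset.mem_insert.1 (Finset.mem_filter.1 hm).1, ?_⟩
  intro d hd h
  exact absurd h.2 (not_lt.2 (hle d (by simp [E, hd, h.1])))

theorem IsPiecewiseDyadic.comp {f g : UnitAddCircle ≃ₜ UnitAddCircle}
    (hf : IsPiecewiseDyadic f) (hg : IsPiecewiseDyadic g) :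
    IsPiecewiseDyadic (fun x => g (f x)) := by
  classical
  obtain ⟨D, hD, hf⟩ := hf
  obtain ⟨E, hE, hg⟩ := hg
  choose r hr0 hr1 hr using exists_rep
  refine ⟨D ∪ (insert 0 E).image (fun e : ℝ => r (f.symm (e : UnitAddCircle))), ?_, ?_⟩
  · intro d hd
    rcases Finset.mem_union.1 hd with hd | hd
    · exact hD d hd
    obtain ⟨e, he, rfl⟩ := Finset.mem_image.1 hd
    have hed : IsDyadic e := by
      rcases Finset.mem_insert.1 he with rfl | he
      · simpa using isDyadic_int 0
      · exact hE e he
    set s := r (f.symm (e : UnitAddCircle)) with hs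
    obtain ⟨q, hsq, hq1, -, hq⟩ := exists_next D (hr1 (f.symm (e : UnitAddCircle)))
    obtain ⟨k, b, hb, h⟩ := hf s q (hr0 _) hsq hq1 hq
    have h1 := h s ⟨le_rfl, hsq.le⟩
    rw [hs, hr, f.apply_symm_apply, ← hs] at h1
    obtain ⟨n, hn⟩ := coe_eq_coe_iff.1 h1
    have : s = (2 : ℝ) ^ (-k) * (e - b - n) := by
      rw [hn, zpow_neg]; field_simp; ring
    rw [this]
    exact ((hed.sub hb).sub (isDyadic_int n)).zpow_mul _
  · intro u v hu huv hv hav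
    obtain ⟨k, b, hb, h⟩ := hf u v hu huv hv
      (fun d hd => hav d (Finset.mem_union_left _ hd))
    have hk : (0 : ℝ) < 2 ^ k := by positivity
    set m := ⌊(2 : ℝ) ^ k * u + b⌋ with hm
    -- no point of `E ∪ {0}` has a lift in the interior of the image of `[u, v]`
    have key : ∀ e ∈ insert 0 E, ∀ n : ℤ,
        e + n ∉ Set.Ioo ((2 : ℝ) ^ k * u + b) ((2 : ℝ) ^ k * v + b) := by
      intro e he n hen
      have hs : ((2 : ℝ) ^ (-k) * (e + n - b)) ∈ Set.Ioo u v := by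
        rw [zpow_neg, inv_mul_eq_div, Set.mem_Ioo, lt_div_iff₀ hk, div_lt_iff₀ hk]
        constructor <;> nlinarith [hen.1, hen.2]
      set s := (2 : ℝ) ^ (-k) * (e + n - b) with hsd
      have h1 := h s ⟨hs.1.le, hs.2.le⟩
      have h2 : (2 : ℝ) ^ k * s + b = e + n := by
        rw [hsd, zpow_neg]; field_simp; ring
      rw [h2] at h1
      have h3 : f.symm (e : UnitAddCircle) = (s : UnitAddCircle) := by
        rw [f.symm_apply_eq, h1]
        exact coe_eq_coe_iff.2 ⟨-n, by push_cast; ring⟩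
      have h4 : r (f.symm (e : UnitAddCircle)) = s := by
        have h5 := hr (f.symm (e : UnitAddCircle))
        rw [h3] at h5 ⊢
        obtain ⟨j, hj⟩ := coe_eq_coe_iff.1 h5
        have a1 := hr0 (s : UnitAddCircle)
        have a2 := hr1 (s : UnitAddCircle)
        have hj0 : j = 0 := by
          have b1 : (-1 : ℝ) < j := by linarith [hs.1, hs.2]
          have b2 : (j : ℝ) < 1 := by linarith [hs.1, hs.2]
          have c1 : (-1 : ℤ) < j := by exact_mod_cast b1
          have c2 : j < (1 : ℤ) := by exact_mod_cast b2
          omega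
        rw [hj, hj0]; simp
      exact hav s (Finset.mem_union_right _ (Finset.mem_image.2 ⟨e, he, h4⟩)) hs
    have hm1 := Int.floor_le ((2 : ℝ) ^ k * u + b)
    have hm2 := Int.lt_floor_add_one ((2 : ℝ) ^ k * u + b)
    have huv' : (2 : ℝ) ^ k * u + b < (2 : ℝ) ^ k * v + b := by nlinarith
    have hv' : (2 : ℝ) ^ k * v + b ≤ m + 1 := by
      by_contra hc
      exact key 0 (Finset.mem_insert_self _ _) (m + 1)
        ⟨by push_cast; linarith, by push_cast; linarith⟩
    obtain ⟨l, c, hc, hl⟩ := hg ((2 : ℝ) ^ k * u + b - m) ((2 : ℝ) ^ k * v + b - m)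
      (by linarith) (by linarith) (by linarith) (fun e he hem =>
        key e (Finset.mem_insert_of_mem he) m ⟨by linarith [hem.1], by linarith [hem.2]⟩)
    refine ⟨l + k, (2 : ℝ) ^ l * (b - m) + c, ((hb.sub (isDyadic_int m)).zpow_mul l).add hc, ?_⟩
    intro s hs
    have h1 : f (s : UnitAddCircle) = (((2 : ℝ) ^ k * s + b - m : ℝ) : UnitAddCircle) := by
      rw [h s hs]; exact coe_eq_coe_iff.2 ⟨m, by ring⟩
    show g (f (s : UnitAddCircle)) = _
    rw [h1, hl _ ⟨by nlinarith [hs.1], by nlinarith [hs.2]⟩, zpow_add₀ two_ne_zero]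
    congr 1; ring

theorem IsPiecewiseDyadic.symm {f : UnitAddCircle ≃ₜ UnitAddCircle}
    (hf : IsPiecewiseDyadic f) : IsPiecewiseDyadic f.symm := by
  classical
  obtain ⟨D, hD, hf⟩ := hf
  choose r hr0 hr1 hr using exists_rep
  -- the images of the break points and of `0`, among them those outside `[0,1)` discarded
  refine ⟨((insert 0 D).filter (fun d => 0 ≤ d ∧ d < 1)).image
    (fun d : ℝ => r (f (d : UnitAddCircle))), ?_, ?_⟩
  · intro e he
    obtain ⟨d, hd, rfl⟩ := Finset.mem_image.1 he
    obtain ⟨hd, hd0, hd1⟩ := Finset.mem_filter.1 hd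
    have hdd : IsDyadic d := by
      rcases Finset.mem_insert.1 hd with rfl | hd
      · simpa using isDyadic_int 0
      · exact hD d hd
    obtain ⟨q, hsq, hq1, -, hq⟩ := exists_next D hd1
    obtain ⟨k, b, hb, h⟩ := hf d q hd0 hsq hq1 hq
    have h1 := h d ⟨le_rfl, hsq.le⟩
    rw [← hr (f (d : UnitAddCircle))] at h1
    obtain ⟨n, hn⟩ := coe_eq_coe_iff.1 h1
    rw [hn]
    exact ((hdd.zpow_mul k).add hb).add (isDyadic_int n)
  · intro u v hu huv hv hav
    set p := r (f.symm (u : UnitAddCircle)) with hp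
    obtain ⟨q, hpq, hq1, hqD, hq⟩ := exists_next D (hr1 (f.symm (u : UnitAddCircle)))
    rw [← hp] at hpq hq
    obtain ⟨k, b, hb, h⟩ := hf p q (hr0 _) hpq hq1 hq
    have hk : (0 : ℝ) < 2 ^ k := by positivity
    have h1 := h p ⟨le_rfl, hpq.le⟩
    rw [hp, hr, f.apply_symm_apply, ← hp] at h1
    obtain ⟨n, hn⟩ := coe_eq_coe_iff.1 h1
    -- the linear piece of `f` which starts at `p` reaches at least up to `v`
    have hvq : v ≤ (2 : ℝ) ^ k * q + b + n := by
      by_contra hc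
      push Not at hc
      have hy1 : u < (2 : ℝ) ^ k * q + b + n := by rw [hn]; nlinarith
      have h2 := h q ⟨hpq.le, le_rfl⟩
      obtain ⟨d, hd, hdq⟩ : ∃ d ∈ (insert 0 D).filter (fun d => 0 ≤ d ∧ d < 1),
          (d : UnitAddCircle) = (q : UnitAddCircle) := by
        rcases hq1.lt_or_eq with hlt | heq
        · have hp0 : 0 ≤ p := hr0 _
          exact ⟨q, Finset.mem_filter.2 ⟨Finset.mem_insert_of_mem
            (hqD.resolve_left hlt.ne), by linarith, hlt⟩, rfl⟩
        · exact ⟨0, by simp, coe_eq_coe_iff.2 ⟨-1, by rw [heq]; simp⟩⟩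
      have h3 : r (f (d : UnitAddCircle)) = (2 : ℝ) ^ k * q + b + n := by
        have h5 := hr (f (d : UnitAddCircle))
        rw [hdq] at h5 ⊢
        rw [h2] at h5
        obtain ⟨j, hj⟩ := coe_eq_coe_iff.1 h5
        rw [h2]
        have a1 := hr0 (((2 : ℝ) ^ k * q + b : ℝ) : UnitAddCircle)
        have a2 := hr1 (((2 : ℝ) ^ k * q + b : ℝ) : UnitAddCircle)
        have hjn : j = n := by
          have b1 : (-1 : ℝ) < j - n := by linarith
          have b2 : (j : ℝ) - n < 1 := by linarith
          have c1 : (-1 : ℤ) < j - n := by exact_mod_cast b1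
          have c2 : j - n < (1 : ℤ) := by exact_mod_cast b2
          omega
        rw [hj, hjn]
      exact hav _ (Finset.mem_image.2 ⟨d, hd, h3⟩) ⟨hy1, hc⟩
    refine ⟨-k, (2 : ℝ) ^ (-k) * (-b - n), (hb.neg.sub (isDyadic_int n)).zpow_mul _, ?_⟩
    intro y hy
    have hz : (2 : ℝ) ^ k * ((2 : ℝ) ^ (-k) * y + (2 : ℝ) ^ (-k) * (-b - n)) + b = y - n := by
      rw [zpow_neg]; field_simp; ring
    rw [f.symm_apply_eq, h _ ⟨?_, ?_⟩, hz]
    · exact coe_eq_coe_iff.2 ⟨n, by ring⟩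
    · refine le_of_mul_le_mul_left ?_ hk
      linarith [hy.1]
    · refine le_of_mul_le_mul_left ?_ hk
      linarith [hy.2]

/-- Thompson's group `T`: the homeomorphisms of the circle which are piecewise linear with finitely
many dyadic break points, with slopes integer powers of `2`, and which preserve the set of dyadic
points. -/
def thompsonT : Subgroup (UnitAddCircle ≃ₜ UnitAddCircle) where
  carrier := {f | IsPiecewiseDyadic f}
  one_mem' := isPiecewiseDyadic_id
  mul_mem' := fun {_ _} hf hg => IsPiecewiseDyadic.comp hg hf
  inv_mem' := fun {_} hf => IsPiecewiseDyadic.symm hf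

/-! ### Pairs of trees

A full binary tree is a term of `BinaryTree Unit`: `nil` is a single leaf, and `node () l r` is a
root whose children are the roots of `l` and `r`. Leaves are numbered from left to right,
starting from `0`. -/

/-- The intervals `[a', b')`, given by their end points, which belong to the leaves of a tree when
`[a, b)` belongs to its root: each inner vertex passes the left half of its interval to its left
child and the right half to its right child. -/
def leafIntervals : BinaryTree Unit → ℝ → ℝ → List (ℝ × ℝ)
  | .nil, a, b => [(a, b)]
  | .node _ l r, a, b => leafIntervals l a ((a + b) / 2) ++ leafIntervals r ((a + b) / 2) b

theorem length_leafIntervals (t : BinaryTree Unit) (a b : ℝ) :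
    (leafIntervals t a b).length = t.numLeaves := by
  induction t generalizing a b with
  | nil => rfl
  | node _ l r hl hr => simp [leafIntervals, hl, hr]

/-- The interval of the `i`-th leaf of `t`, where `[0,1)` belongs to the root. -/
def leafInterval (t : BinaryTree Unit) (i : Fin t.numLeaves) : ℝ × ℝ :=
  (leafIntervals t 0 1).get (i.cast (length_leafIntervals t 0 1).symm)

/-- A pair of full binary trees with the same number of leaves, whose leaves are identified
cyclically. The first leaf of the input tree is identified with the leaf number `shift` of the
output tree; as leaves are counted from `0`, this is the triple `(R, S, shift + 1)` when they are
counted from `1`. -/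
structure TreePair where
  input : BinaryTree Unit
  output : BinaryTree Unit
  numLeaves_eq : input.numLeaves = output.numLeaves
  shift : Fin input.numLeaves

/-- The leaf of the output tree with which a leaf of the input tree is identified. The addition is
modulo the number of leaves. -/
def TreePair.glue (P : TreePair) (i : Fin P.input.numLeaves) : Fin P.output.numLeaves :=
  (i + P.shift).cast P.numLeaves_eq

/-- `P` represents `f`: the interval of each leaf of the input tree is mapped by `f` linearly and
increasingly onto the interval of the leaf of the output tree identified with it. -/
def TreePair.Represents (P : TreePair) (f : UnitAddCircle → UnitAddCircle) : Prop :=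
  ∀ i : Fin P.input.numLeaves,
    let I := leafInterval P.input i
    let J := leafInterval P.output (P.glue i)
    ∀ s ∈ Set.Ico I.1 I.2,
      f (s : UnitAddCircle) = ((J.1 + (J.2 - J.1) / (I.2 - I.1) * (s - I.1) : ℝ) : UnitAddCircle)

/-- `IsExposedCaret t i`: the leaves `i` and `i + 1` of `t` are the two children of one vertex. -/
inductive IsExposedCaret : BinaryTree Unit → ℕ → Prop
  | root : IsExposedCaret (.node () .nil .nil) 0
  | left {l r : BinaryTree Unit} {i : ℕ} :
      IsExposedCaret l i → IsExposedCaret (.node () l r) i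
  | right {l r : BinaryTree Unit} {i : ℕ} :
      IsExposedCaret r i → IsExposedCaret (.node () l r) (l.numLeaves + i)

/-- A pair of trees is reduced if no dipole can be removed from it: there is no exposed caret of the
input tree whose left and right leaves are identified with the left and right leaves of an exposed
caret of the output tree. -/
def TreePair.IsReduced (P : TreePair) : Prop :=
  ¬ ∃ i i' : Fin P.input.numLeaves, (i' : ℕ) = i + 1 ∧ ((P.glue i' : ℕ) = P.glue i + 1) ∧
    IsExposedCaret P.input i ∧ IsExposedCaret P.output (P.glue i)

/-! ### Thompson graphs -/

/-- The edges of the Thompson graph of a tree. The vertex `i` lies on the horizontal line of the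
leaves, directly to the left of the leaf `i`. If the lower end of a left edge `e` carries the
subtree with the leaves `i, …, j - 1`, then the vertices which can be joined by a path that stays
above the line and passes through the tree only at `e` are `i` (on the left of this subtree) and
`j` (on its right). There is one left edge for each inner vertex of the tree. -/
inductive ThompsonEdge : BinaryTree Unit → ℕ → ℕ → Prop
  | root {l r : BinaryTree Unit} : ThompsonEdge (.node () l r) 0 l.numLeaves
  | left {l r : BinaryTree Unit} {i j : ℕ} :
      ThompsonEdge l i j → ThompsonEdge (.node () l r) i j
  | right {l r : BinaryTree Unit} {i j : ℕ} :
      ThompsonEdge r i j → ThompsonEdge (.node () l r) (l.numLeaves + i) (l.numLeaves + j)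

/-- The Thompson graph of a full binary tree. -/
def treeGraph (t : BinaryTree Unit) : SimpleGraph (Fin t.numLeaves) :=
  SimpleGraph.fromRel (fun i j => ThompsonEdge t i j)

/-- The Thompson graph of a pair of trees: the Thompson graphs of the two trees, with their vertices
identified in the same way as the leaves. -/
def TreePair.thompsonGraph (P : TreePair) : SimpleGraph (Fin P.input.numLeaves) :=
  treeGraph P.input ⊔ (treeGraph P.output).comap P.glue

/-- Jones' subgroup of `T`: the elements of `T` whose Thompson graph, the Thompson graph of their
reduced pair of trees, is bipartite. -/
def jonesT : Set (UnitAddCircle ≃ₜ UnitAddCircle) :=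
  {f | f ∈ thompsonT ∧
    ∃ P : TreePair, P.Represents f ∧ P.IsReduced ∧ P.thompsonGraph.IsBipartite}

/-- Jones' subgroup of `F`: the elements with bipartite Thompson graph of Thompson's group `F`,
which is the stabilizer of `0` in `T`. -/
def jonesF : Set (UnitAddCircle ≃ₜ UnitAddCircle) :=
  {f | f ∈ jonesT ∧ f 0 = 0}

/-! ### The generators -/

/-- The function `x₀` on `[0,1]`. -/
def x0Fun (t : ℝ) : ℝ :=
  if t < 1 / 4 then 2 * t else if t < 1 / 2 then t + 1 / 4 else t / 2 + 1 / 2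

/-- The inverse function of `x₀` on `[0,1]`. -/
def x0Inv (t : ℝ) : ℝ :=
  if t < 1 / 2 then t / 2 else if t < 3 / 4 then t - 1 / 4 else 2 * t - 1

theorem x0Fun_mem (t : unitInterval) : x0Fun t ∈ unitInterval := by
  have h0 := t.2.1
  have h1 := t.2.2
  unfold x0Fun
  split_ifs <;> constructor <;> linarith

theorem x0Inv_mem (t : unitInterval) : x0Inv t ∈ unitInterval := by
  have h0 := t.2.1
  have h1 := t.2.2
  unfold x0Inv
  split_ifs <;> constructor <;> linarith

/-- `x₀` as an increasing bijection of `[0,1]`. -/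
def x0Iso : unitInterval ≃o unitInterval :=
  StrictMono.orderIsoOfRightInverse (fun t => ⟨x0Fun t, x0Fun_mem t⟩)
    (by
      intro s t hst
      have hst : (s : ℝ) < t := hst
      show x0Fun s < x0Fun t
      unfold x0Fun
      split_ifs <;> linarith)
    (fun t => ⟨x0Inv t, x0Inv_mem t⟩)
    (by
      intro t
      apply Subtype.ext
      show x0Fun (x0Inv t) = t
      unfold x0Fun x0Inv
      split_ifs <;> linarith)

theorem two_mul_mem {t : unitInterval} (h : (t : ℝ) ≤ 1 / 2) : 2 * (t : ℝ) ∈ unitInterval :=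
  ⟨by linarith [t.2.1], by linarith⟩

theorem two_mul_sub_one_mem {t : unitInterval} (h : ¬ (t : ℝ) ≤ 1 / 2) :
    2 * (t : ℝ) - 1 ∈ unitInterval :=
  ⟨by linarith, by linarith [t.2.2]⟩

/-- The function `(f ⊕ g)(t)`: it is `f(2t)/2` for `t ∈ [0,1/2]` and `(g(2t-1)+1)/2` for
`t ∈ (1/2,1]`. -/
def oplusFun (f g : unitInterval ≃o unitInterval) (t : unitInterval) : unitInterval :=
  if h : (t : ℝ) ≤ 1 / 2 then
    ⟨(f ⟨2 * t, two_mul_mem h⟩ : ℝ) / 2,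
      by linarith [(f ⟨2 * t, two_mul_mem h⟩).2.1],
      by linarith [(f ⟨2 * t, two_mul_mem h⟩).2.2]⟩
  else
    ⟨((g ⟨2 * t - 1, two_mul_sub_one_mem h⟩ : ℝ) + 1) / 2,
      by linarith [(g ⟨2 * t - 1, two_mul_sub_one_mem h⟩).2.1],
      by linarith [(g ⟨2 * t - 1, two_mul_sub_one_mem h⟩).2.2]⟩

theorem oplusFun_strictMono (f g : unitInterval ≃o unitInterval) : StrictMono (oplusFun f g) := by
  intro s t hst
  have hst : (s : ℝ) < t := hst
  show (oplusFun f g s : ℝ) < oplusFun f g t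
  unfold oplusFun
  split_ifs with h1 h2 h2
  · have : f ⟨2 * s, two_mul_mem h1⟩ < f ⟨2 * t, two_mul_mem h2⟩ :=
      f.strictMono (Subtype.mk_lt_mk.2 (by linarith))
    have : (f ⟨2 * s, two_mul_mem h1⟩ : ℝ) < f ⟨2 * t, two_mul_mem h2⟩ := this
    show (_ : ℝ) / 2 < _ / 2
    linarith
  · have h3 := (f ⟨2 * s, two_mul_mem h1⟩).2.2
    have : g ⊥ < g ⟨2 * t - 1, two_mul_sub_one_mem h2⟩ :=
      g.strictMono (Subtype.mk_lt_mk.2 (by linarith))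
    rw [g.map_bot] at this
    have : (0 : ℝ) < g ⟨2 * t - 1, two_mul_sub_one_mem h2⟩ := this
    show (_ : ℝ) / 2 < (_ + 1) / 2
    linarith
  · linarith
  · have : g ⟨2 * s - 1, two_mul_sub_one_mem h1⟩ < g ⟨2 * t - 1, two_mul_sub_one_mem h2⟩ :=
      g.strictMono (Subtype.mk_lt_mk.2 (by linarith))
    have : (g ⟨2 * s - 1, two_mul_sub_one_mem h1⟩ : ℝ) <
      g ⟨2 * t - 1, two_mul_sub_one_mem h2⟩ := this
    show ((_ : ℝ) + 1) / 2 < (_ + 1) / 2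
    linarith

theorem oplusFun_symm (f g : unitInterval ≃o unitInterval) :
    Function.RightInverse (oplusFun f.symm g.symm) (oplusFun f g) := by
  intro t
  apply Subtype.ext
  by_cases h : (t : ℝ) ≤ 1 / 2
  · have h1 : oplusFun f.symm g.symm t = ⟨(f.symm ⟨2 * t, two_mul_mem h⟩ : ℝ) / 2,
      by linarith [(f.symm ⟨2 * t, two_mul_mem h⟩).2.1],
      by linarith [(f.symm ⟨2 * t, two_mul_mem h⟩).2.2]⟩ := dif_pos h
    rw [h1, oplusFun, dif_pos (by show (_ : ℝ) / 2 ≤ 1 / 2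
                                  linarith [(f.symm ⟨2 * t, two_mul_mem h⟩).2.2])]
    have h2 : ∀ p, (⟨2 * ((f.symm ⟨2 * t, two_mul_mem h⟩ : ℝ) / 2), p⟩ : unitInterval) =
        f.symm ⟨2 * t, two_mul_mem h⟩ := fun p => Subtype.ext (by show 2 * (_ / 2) = _; ring)
    simp only [h2, OrderIso.apply_symm_apply]
    ring
  · have h0 : g.symm ⊥ < g.symm ⟨2 * t - 1, two_mul_sub_one_mem h⟩ :=
      g.symm.strictMono (Subtype.mk_lt_mk.2 (by linarith))
    rw [g.symm.map_bot] at h0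
    have h0 : (0 : ℝ) < g.symm ⟨2 * t - 1, two_mul_sub_one_mem h⟩ := h0
    have h1 : oplusFun f.symm g.symm t =
      ⟨((g.symm ⟨2 * t - 1, two_mul_sub_one_mem h⟩ : ℝ) + 1) / 2,
      by linarith [(g.symm ⟨2 * t - 1, two_mul_sub_one_mem h⟩).2.1],
      by linarith [(g.symm ⟨2 * t - 1, two_mul_sub_one_mem h⟩).2.2]⟩ := dif_neg h
    rw [h1, oplusFun, dif_neg (by show ¬ ((_ : ℝ) + 1) / 2 ≤ 1 / 2
                                  linarith)]
    have h2 : ∀ p, (⟨2 * (((g.symm ⟨2 * t - 1, two_mul_sub_one_mem h⟩ : ℝ) + 1) / 2) - 1, p⟩ : unitInterval) =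
        g.symm ⟨2 * t - 1, two_mul_sub_one_mem h⟩ :=
      fun p => Subtype.ext (by show 2 * ((_ + 1) / 2) - 1 = _; ring)
    simp only [h2, OrderIso.apply_symm_apply]
    ring

/-- The sum `f ⊕ g` of two increasing bijections of `[0,1]`. -/
def oplus (f g : unitInterval ≃o unitInterval) : unitInterval ≃o unitInterval :=
  StrictMono.orderIsoOfRightInverse (oplusFun f g) (oplusFun_strictMono f g)
    (oplusFun f.symm g.symm) (oplusFun_symm f g)

/-- The elements `x₀, x₁, x₂, …` of `F` on `[0,1]`, where `xₙ₊₁ = 1 ⊕ xₙ`. -/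
def xIso : ℕ → (unitInterval ≃o unitInterval)
  | 0 => x0Iso
  | n + 1 => oplus (OrderIso.refl unitInterval) (xIso n)

/-- The map of the circle induced by an increasing bijection of `[0,1]`. -/
def inducedMap (g : unitInterval ≃o unitInterval) : UnitAddCircle → UnitAddCircle :=
  AddCircle.liftIco 1 0 fun t : ℝ => ((g (Set.projIcc 0 1 zero_le_one t) : ℝ) : UnitAddCircle)

theorem inducedMap_coe (g : unitInterval ≃o unitInterval) {t : ℝ} (h0 : 0 ≤ t) (h1 : t < 1) :
    inducedMap g (t : UnitAddCircle) = ((g ⟨t, h0, h1.le⟩ : ℝ) : UnitAddCircle) := by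
  rw [inducedMap, AddCircle.liftIco_zero_coe_apply ⟨h0, h1⟩,
    Set.projIcc_of_mem zero_le_one ⟨h0, h1.le⟩]

theorem continuous_inducedMap (g : unitInterval ≃o unitInterval) : Continuous (inducedMap g) := by
  apply AddCircle.liftIco_zero_continuous
  · rw [Set.projIcc_left, Set.projIcc_right]
    have h0 : g ⟨0, Set.left_mem_Icc.2 zero_le_one⟩ = ⊥ := g.map_bot
    have h1 : g ⟨1, Set.right_mem_Icc.2 zero_le_one⟩ = ⊤ := g.map_top
    rw [h0, h1]
    show ((0 : ℝ) : UnitAddCircle) = ((1 : ℝ) : UnitAddCircle)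
    rw [AddCircle.coe_zero]; exact (AddCircle.coe_period 1).symm
  · exact ((AddCircle.continuous_mk' 1).comp (continuous_subtype_val.comp
      (g.continuous.comp continuous_projIcc))).continuousOn

theorem inducedMap_symm (g : unitInterval ≃o unitInterval) (x : UnitAddCircle) :
    inducedMap g.symm (inducedMap g x) = x := by
  obtain ⟨t, h0, h1, rfl⟩ := exists_rep x
  have h2 : g ⟨t, h0, h1.le⟩ < g ⊤ := g.strictMono (Subtype.mk_lt_mk.2 h1)
  rw [g.map_top] at h2
  rw [inducedMap_coe g h0 h1, inducedMap_coe g.symm (g ⟨t, h0, h1.le⟩).2.1 h2]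
  exact congrArg (fun s : unitInterval => ((s : ℝ) : UnitAddCircle))
    (g.symm_apply_apply ⟨t, h0, h1.le⟩)

/-- The homeomorphism of the circle induced by an increasing bijection of `[0,1]`. -/
def circleHomeo (g : unitInterval ≃o unitInterval) : UnitAddCircle ≃ₜ UnitAddCircle where
  toFun := inducedMap g
  invFun := inducedMap g.symm
  left_inv := inducedMap_symm g
  right_inv := inducedMap_symm g.symm
  continuous_toFun := continuous_inducedMap g
  continuous_invFun := continuous_inducedMap g.symm

/-- The element `xₙ` of `F`, as a homeomorphism of the circle. -/
def xGen (n : ℕ) : UnitAddCircle ≃ₜ UnitAddCircle := circleHomeo (xIso n)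

/-- The rotation `f_{1/2}`, `t ↦ t + 1/2` modulo `1`. -/
def rotHalf : UnitAddCircle ≃ₜ UnitAddCircle :=
  Homeomorph.addRight (((1 / 2 : ℝ)) : UnitAddCircle)

/-- The product `f g` in `T`, where elements are multiplied from left to right:
first `f`, then `g`. -/
def prodLR (f g : UnitAddCircle ≃ₜ UnitAddCircle) : UnitAddCircle ≃ₜ UnitAddCircle := f.trans g

end JonesThompson

end

/-!
An element `f` of `T` has a bipartite Thompson graph if and only if it changes the parity of the
sum of the binary digits by the same amount at all dyadic points of the circle; from this
description, `jonesT` is plainly a subgroup.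

For the equivalence, color each leaf of a tree by the parity of the number of right edges on the
path to it, which is the digit parity of the left end point of its interval. The Thompson graph of a
tree is connected, and this is its only proper coloring up to exchanging the colors. So the Thompson
graph of a pair of trees is bipartite if and only if the colors of identified leaves either always
agree or always differ (`TreePair.isBipartite_iff`), which is a statement about `f` and not about
the pair (`TreePair.Represents.isBipartite_iff`). Together with the existence of a pair of trees
(`exists_represents`), and of a reduced one, this gives `jonesT_eq`.

For the generators, put `yₙ = xₙ xₙ₊₁`. Conjugation by `y₀` maps `yₙ₊₁` to `yₙ₊₃`
(`yGen_relation`), so all `yₙ` are in the subgroup `H` generated by `y₀`, `y₁`, `y₂` and the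
rotation. Already `y₀` and the rotation act transitively on dyadic points (`exists_map_to_zero`), so
it is enough to show that an element of `jonesT` which fixes `0` belongs to `H`. It maps the leaves
of a tree `R` to the leaves of a tree `S` with the same sequence of colors. Bisecting each leaf
whose right neighbor has the same color, in both trees, makes this sequence alternate. The trees
with alternating colors are the ternary trees, where a vertex with three children is drawn as two
carets, and the trees made of a caret with two ternary trees (`isTernary_of_alternating`). By means
of the `yₙ` a ternary tree can be spread out on a path of right edges
(`IsTernary.treeEquiv_comb`). So elements of `H` map the leaves of `R` and those of `S` to the
leaves of the same comb, and the given element is a quotient of two elements of `H`.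
-/

namespace JonesThompson

/-! ### Linear maps between intervals of the circle -/

/-- `f` maps the half-open interval `I` linearly and increasingly onto the interval `J`. -/
def LinOn (f : UnitAddCircle → UnitAddCircle) (I J : ℝ × ℝ) : Prop :=
  ∀ s ∈ Set.Ico I.1 I.2,
    f (s : UnitAddCircle) = ((J.1 + (J.2 - J.1) / (I.2 - I.1) * (s - I.1) : ℝ) : UnitAddCircle)

theorem LinOn.map_left {f : UnitAddCircle → UnitAddCircle} {I J : ℝ × ℝ} (h : LinOn f I J)
    (hI : I.1 < I.2) : f (I.1 : UnitAddCircle) = (J.1 : UnitAddCircle) := by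
  rw [h I.1 ⟨le_rfl, hI⟩, sub_self, mul_zero, add_zero]

theorem LinOn.leftHalf {f : UnitAddCircle → UnitAddCircle} {a b c d : ℝ}
    (h : LinOn f (a, b) (c, d)) (hab : a < b) :
    LinOn f (a, (a + b) / 2) (c, (c + d) / 2) := by
  intro s hs
  obtain ⟨h1, h2⟩ : a ≤ s ∧ s < (a + b) / 2 := hs
  rw [h s ⟨h1, by dsimp only; linarith⟩]
  congr 1
  have h3 : b - a ≠ 0 := by linarith
  have h4 : (a + b) / 2 - a = (b - a) / 2 := by ring
  dsimp only
  rw [h4]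
  field_simp
  ring

theorem LinOn.rightHalf {f : UnitAddCircle → UnitAddCircle} {a b c d : ℝ}
    (h : LinOn f (a, b) (c, d)) :
    LinOn f ((a + b) / 2, b) ((c + d) / 2, d) := by
  intro s hs
  obtain ⟨h1, h2⟩ : (a + b) / 2 ≤ s ∧ s < b := hs
  rw [h s ⟨by dsimp only; linarith, h2⟩]
  congr 1
  have h3 : b - a ≠ 0 := by linarith
  have h4 : b - (a + b) / 2 = (b - a) / 2 := by ring
  dsimp only
  rw [h4]
  field_simp
  ring

theorem LinOn.of_halves {f : UnitAddCircle → UnitAddCircle} {a b c d : ℝ}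
    (h1 : LinOn f (a, (a + b) / 2) (c, (c + d) / 2))
    (h2 : LinOn f ((a + b) / 2, b) ((c + d) / 2, d)) (hab : a < b) :
    LinOn f (a, b) (c, d) := by
  intro s hs
  obtain ⟨hs1, hs2⟩ : a ≤ s ∧ s < b := hs
  have h3 : b - a ≠ 0 := by linarith
  have h4 : b - (a + b) / 2 = (b - a) / 2 := by ring
  have h5 : (a + b) / 2 - a = (b - a) / 2 := by ring
  rcases lt_or_ge s ((a + b) / 2) with h | h
  · rw [h1 s ⟨hs1, h⟩]
    congr 1
    dsimp only
    rw [h5]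
    field_simp
    ring
  · rw [h2 s ⟨h, hs2⟩]
    congr 1
    dsimp only
    rw [h4]
    field_simp
    ring

theorem LinOn.trans {f g : UnitAddCircle ≃ₜ UnitAddCircle} {I J K : ℝ × ℝ}
    (hf : LinOn f I J) (hg : LinOn g J K) (hI : I.1 < I.2) (hJ : J.1 < J.2) :
    LinOn (f.trans g) I K := by
  intro s hs
  have hI' : 0 < I.2 - I.1 := by linarith
  have hJ' : 0 < J.2 - J.1 := by linarith
  have h0 : 0 ≤ (J.2 - J.1) / (I.2 - I.1) * (s - I.1) :=
    mul_nonneg (by positivity) (by linarith [hs.1])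
  have h1 : (J.2 - J.1) / (I.2 - I.1) * (s - I.1) < J.2 - J.1 := by
    rw [div_mul_eq_mul_div, div_lt_iff₀ hI']
    exact mul_lt_mul_of_pos_left (by linarith [hs.2]) hJ'
  rw [Homeomorph.trans_apply, hf s hs, hg _ ⟨by linarith, by linarith⟩]
  congr 1
  field_simp
  ring

theorem LinOn.symm {f : UnitAddCircle ≃ₜ UnitAddCircle} {I J : ℝ × ℝ}
    (hf : LinOn f I J) (hI : I.1 < I.2) (hJ : J.1 < J.2) : LinOn f.symm J I := by
  intro s hs
  have hI' : 0 < I.2 - I.1 := by linarith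
  have hJ' : 0 < J.2 - J.1 := by linarith
  have h0 : 0 ≤ (I.2 - I.1) / (J.2 - J.1) * (s - J.1) :=
    mul_nonneg (by positivity) (by linarith [hs.1])
  have h1 : (I.2 - I.1) / (J.2 - J.1) * (s - J.1) < I.2 - I.1 := by
    rw [div_mul_eq_mul_div, div_lt_iff₀ hJ']
    exact mul_lt_mul_of_pos_left (by linarith [hs.2]) hI'
  rw [f.symm_apply_eq, hf _ ⟨by linarith, by linarith⟩]
  congr 1
  field_simp
  ring

/-- `f` maps the intervals of the list `L` linearly and increasingly onto the intervals of the
list `M`, in this order. -/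
abbrev MapsIntervals (f : UnitAddCircle → UnitAddCircle) (L M : List (ℝ × ℝ)) : Prop :=
  List.Forall₂ (LinOn f) L M

theorem MapsIntervals.trans {f g : UnitAddCircle ≃ₜ UnitAddCircle} {L M N : List (ℝ × ℝ)}
    (hf : MapsIntervals f L M) (hg : MapsIntervals g M N)
    (hL : ∀ I ∈ L, I.1 < I.2) (hM : ∀ I ∈ M, I.1 < I.2) : MapsIntervals (f.trans g) L N := by
  induction hf generalizing N with
  | nil => cases hg; exact .nil
  | cons h1 _ ih =>
    cases hg with
    | cons h2 h3 =>
      exact .cons (h1.trans h2 (hL _ (by simp)) (hM _ (by simp)))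
        (ih h3 (fun I hI => hL I (by simp [hI])) (fun I hI => hM I (by simp [hI])))

theorem MapsIntervals.symm {f : UnitAddCircle ≃ₜ UnitAddCircle} {L M : List (ℝ × ℝ)}
    (hf : MapsIntervals f L M)
    (hL : ∀ I ∈ L, I.1 < I.2) (hM : ∀ I ∈ M, I.1 < I.2) : MapsIntervals f.symm M L := by
  induction hf with
  | nil => exact .nil
  | cons h1 _ ih =>
    exact .cons (h1.symm (hL _ (by simp)) (hM _ (by simp)))
      (ih (fun I hI => hL I (by simp [hI])) (fun I hI => hM I (by simp [hI])))

theorem MapsIntervals.append {f : UnitAddCircle → UnitAddCircle} {L L' M M' : List (ℝ × ℝ)}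
    (h : MapsIntervals f L M) (h' : MapsIntervals f L' M') :
    MapsIntervals f (L ++ L') (M ++ M') := List.rel_append h h'

/-! ### The intervals of the leaves of a tree -/

theorem leafIntervals_bounds (t : BinaryTree Unit) {a b : ℝ} (hab : a < b) :
    ∀ I ∈ leafIntervals t a b, a ≤ I.1 ∧ I.1 < I.2 ∧ I.2 ≤ b := by
  induction t generalizing a b with
  | nil => simp [leafIntervals, hab]
  | node _ l r hl hr =>
    intro I hI
    rcases List.mem_append.1 hI with h | h
    · have := hl (a := a) (b := (a + b) / 2) (by linarith) I h
      exact ⟨this.1, this.2.1, by linarith⟩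
    · have := hr (a := (a + b) / 2) (b := b) (by linarith) I h
      exact ⟨by linarith, this.2.1, this.2.2⟩

theorem leafIntervals_pos (t : BinaryTree Unit) {a b : ℝ} (hab : a < b) :
    ∀ I ∈ leafIntervals t a b, I.1 < I.2 :=
  fun I hI => (leafIntervals_bounds t hab I hI).2.1

theorem exists_mem_leafIntervals (t : BinaryTree Unit) {a b s : ℝ} (hs : s ∈ Set.Ico a b) :
    ∃ I ∈ leafIntervals t a b, s ∈ Set.Ico I.1 I.2 := by
  induction t generalizing a b with
  | nil => exact ⟨(a, b), by simp [leafIntervals], hs⟩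
  | node _ l r hl hr =>
    rcases lt_or_ge s ((a + b) / 2) with h | h
    · obtain ⟨I, hI, hI'⟩ := hl ⟨hs.1, h⟩
      exact ⟨I, List.mem_append_left _ hI, hI'⟩
    · obtain ⟨I, hI, hI'⟩ := hr ⟨h, hs.2⟩
      exact ⟨I, List.mem_append_right _ hI, hI'⟩

theorem pairwise_leafIntervals (t : BinaryTree Unit) {a b : ℝ} (hab : a < b) :
    (leafIntervals t a b).Pairwise (fun I J => I.2 ≤ J.1) := by
  induction t generalizing a b with
  | nil => simp [leafIntervals]
  | node _ l r hl hr =>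
    refine List.pairwise_append.2 ⟨hl (by linarith), hr (by linarith), fun I hI J hJ => ?_⟩
    exact (leafIntervals_bounds l (by linarith) I hI).2.2.trans
      (leafIntervals_bounds r (by linarith) J hJ).1

/-- The first leaf of a tree starts where the interval of the root starts. -/
theorem leafIntervals_eq_cons (t : BinaryTree Unit) (a b : ℝ) :
    ∃ x L, leafIntervals t a b = (a, x) :: L := by
  induction t generalizing a b with
  | nil => exact ⟨b, [], rfl⟩
  | node _ l r hl hr =>
    obtain ⟨x, L, h⟩ := hl a ((a + b) / 2)
    exact ⟨x, L ++ leafIntervals r ((a + b) / 2) b, by rw [leafIntervals, h, List.cons_append]⟩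

/-- A map which is linear on an interval is linear on the subdivision of it given by a tree. -/
theorem LinOn.mapsIntervals_leafIntervals {f : UnitAddCircle → UnitAddCircle}
    (t : BinaryTree Unit) {a b c d : ℝ} (hab : a < b) (h : LinOn f (a, b) (c, d)) :
    MapsIntervals f (leafIntervals t a b) (leafIntervals t c d) := by
  induction t generalizing a b c d with
  | nil => exact .cons h .nil
  | node _ l r hl hr =>
    exact (hl (by linarith) (h.leftHalf hab)).append (hr (by linarith) (h.rightHalf))

/-- A map of the circle is determined by what it does on the leaves of a tree. -/
theorem MapsIntervals.unique {f g : UnitAddCircle ≃ₜ UnitAddCircle} {t : BinaryTree Unit}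
    {M : List (ℝ × ℝ)} (hf : MapsIntervals f (leafIntervals t 0 1) M)
    (hg : MapsIntervals g (leafIntervals t 0 1) M) : f = g := by
  ext x
  obtain ⟨s, h0, h1, rfl⟩ := exists_rep x
  obtain ⟨I, hI, hs⟩ := exists_mem_leafIntervals t (a := 0) (b := 1) ⟨h0, h1⟩
  obtain ⟨i, hi, rfl⟩ := List.getElem_of_mem hI
  have hl := hf.length_eq
  rw [(List.forall₂_iff_get.1 hf).2 i hi (hl ▸ hi) s hs,
    (List.forall₂_iff_get.1 hg).2 i hi (hl ▸ hi) s hs]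

/-! ### The parity of the binary digits of a dyadic number -/

/-- The positions of the digits `1` after the binary point, counted from `0`. -/
def binaryOnes (x : ℝ) : Set ℕ := {n | ¬ Even ⌊(2 : ℝ) ^ (n + 1) * x⌋}

/-- The number of digits `1` after the binary point, modulo `2`. It has this meaning if these
digits are finitely many, as they are for a dyadic `x`. -/
noncomputable def digitParity (x : ℝ) : ZMod 2 := (binaryOnes x).ncard

theorem binaryOnes_add_int (x : ℝ) (n : ℤ) : binaryOnes (x + n) = binaryOnes x := by
  ext m
  have : (2 : ℝ) ^ (m + 1) * (x + n) = 2 ^ (m + 1) * x + ((2 ^ (m + 1) * n : ℤ) : ℝ) := by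
    push_cast; ring
  simp only [binaryOnes, Set.mem_ofPred_eq]
  rw [this, Int.floor_add_intCast, Int.even_add]
  simp [pow_succ]

theorem digitParity_add_int (x : ℝ) (n : ℤ) : digitParity (x + n) = digitParity x := by
  rw [digitParity, digitParity, binaryOnes_add_int]

theorem binaryOnes_div_two {x : ℝ} (h0 : 0 ≤ x) (h1 : x < 1) :
    binaryOnes (x / 2) = Nat.succ '' binaryOnes x := by
  ext m
  cases m with
  | zero =>
    have : ⌊x⌋ = 0 := Int.floor_eq_zero_iff.2 ⟨h0, h1⟩
    simp [binaryOnes, mul_div_cancel₀, this]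
  | succ m =>
    have : (2 : ℝ) ^ (m + 1 + 1) * (x / 2) = 2 ^ (m + 1) * x := by ring
    simp [binaryOnes, this]

theorem binaryOnes_add_one_div_two {x : ℝ} (h0 : 0 ≤ x) (h1 : x < 1) :
    binaryOnes ((x + 1) / 2) = insert 0 (Nat.succ '' binaryOnes x) := by
  ext m
  cases m with
  | zero =>
    have : ⌊x⌋ = 0 := Int.floor_eq_zero_iff.2 ⟨h0, h1⟩
    simp [binaryOnes, mul_div_cancel₀, this]
  | succ m =>
    have : (2 : ℝ) ^ (m + 1 + 1) * ((x + 1) / 2) = 2 ^ (m + 1) * (x + (1 : ℤ)) := by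
      push_cast; ring
    have h2 : m ∈ binaryOnes (x + (1 : ℤ)) ↔ m ∈ binaryOnes x := by rw [binaryOnes_add_int]
    simp only [binaryOnes, Set.mem_ofPred_eq] at h2
    simp only [binaryOnes, Set.mem_ofPred_eq, this, h2]
    simp

theorem exists_eq_int_div_two_pow {x : ℝ} (hx : IsDyadic x) :
    ∃ (m : ℤ) (n : ℕ), x = m / 2 ^ n := by
  obtain ⟨a, k, rfl⟩ := hx
  obtain ⟨n, rfl | rfl⟩ := k.eq_nat_or_neg
  · exact ⟨a * 2 ^ n, 0, by simp⟩
  · exact ⟨a, n, by rw [zpow_neg, zpow_natCast]; rfl⟩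

theorem finite_binaryOnes {x : ℝ} (hx : IsDyadic x) : (binaryOnes x).Finite := by
  obtain ⟨a, n, rfl⟩ := exists_eq_int_div_two_pow hx
  refine (Set.finite_lt_nat n).subset fun m hm => ?_
  by_contra hc
  obtain ⟨j, rfl⟩ := Nat.exists_eq_add_of_le (not_lt.1 hc)
  apply hm
  have : (2 : ℝ) ^ (n + j + 1) * (a / 2 ^ n) = ((2 * (2 ^ j * a) : ℤ) : ℝ) := by
    push_cast; field_simp; ring
  rw [this, Int.floor_intCast]
  exact even_two_mul _

theorem digitParity_zero : digitParity 0 = 0 := by simp [digitParity, binaryOnes]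

theorem digitParity_div_two {x : ℝ} (h0 : 0 ≤ x) (h1 : x < 1) :
    digitParity (x / 2) = digitParity x := by
  rw [digitParity, binaryOnes_div_two h0 h1, Set.ncard_image_of_injective _ Nat.succ_injective,
    digitParity]

theorem digitParity_add_one_div_two {x : ℝ} (hx : IsDyadic x) (h0 : 0 ≤ x) (h1 : x < 1) :
    digitParity ((x + 1) / 2) = digitParity x + 1 := by
  rw [digitParity, binaryOnes_add_one_div_two h0 h1, Set.ncard_insert_of_notMem (by simp)
    ((finite_binaryOnes hx).image _), Set.ncard_image_of_injective _ Nat.succ_injective,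
    digitParity]
  push_cast; rfl

/-! ### Colored dyadic intervals -/

/-- `[a, b)` is an interval of length a power of `2` with dyadic end points such that the digits
of its points are those of `y ∈ [0,1)` behind a prefix of parity `c`, where `y` is the relative
position in the interval. -/
def IsCone (a b : ℝ) (c : ZMod 2) : Prop :=
  IsDyadic a ∧ (∃ k : ℤ, b - a = (2 : ℝ) ^ k) ∧
    ∀ y, IsDyadic y → 0 ≤ y → y < 1 → digitParity (a + (b - a) * y) = c + digitParity y

theorem isCone_zero_one : IsCone 0 1 0 :=
  ⟨by simpa using isDyadic_int 0, ⟨0, by simp⟩, fun y _ _ _ => by simp⟩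

theorem IsCone.lt {a b : ℝ} {c : ZMod 2} (h : IsCone a b c) : a < b := by
  obtain ⟨-, ⟨k, hk⟩, -⟩ := h
  have : (0 : ℝ) < 2 ^ k := by positivity
  linarith

theorem IsDyadic.div_two {x : ℝ} (hx : IsDyadic x) : IsDyadic (x / 2) := by
  have := hx.zpow_mul (-1)
  rwa [zpow_neg_one, inv_mul_eq_div] at this

theorem IsCone.isDyadic_right {a b : ℝ} {c : ZMod 2} (h : IsCone a b c) : IsDyadic b := by
  obtain ⟨ha, ⟨k, hk⟩, -⟩ := h
  have : IsDyadic ((2 : ℝ) ^ k * 1) := IsDyadic.zpow_mul (by simpa using isDyadic_int 1) k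
  rw [mul_one, ← hk] at this
  simpa using ha.add this

theorem IsCone.leftHalf {a b : ℝ} {c : ZMod 2} (h : IsCone a b c) :
    IsCone a ((a + b) / 2) c := by
  obtain ⟨ha, ⟨k, hk⟩, hy⟩ := h
  refine ⟨ha, ⟨k - 1, by rw [zpow_sub_one₀ two_ne_zero, ← hk]; ring⟩, fun y hd h0 h1 => ?_⟩
  rw [← digitParity_div_two h0 h1, ← hy _ hd.div_two (by linarith) (by linarith)]
  congr 1; ring

theorem IsCone.rightHalf {a b : ℝ} {c : ZMod 2} (h : IsCone a b c) :
    IsCone ((a + b) / 2) b (c + 1) := by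
  have hb := h.isDyadic_right
  obtain ⟨ha, ⟨k, hk⟩, hy⟩ := h
  refine ⟨(ha.add hb).div_two,
    ⟨k - 1, by rw [zpow_sub_one₀ two_ne_zero, ← hk]; ring⟩, fun y hd h0 h1 => ?_⟩
  have h2 : IsDyadic ((y + 1) / 2) := (hd.add (by simpa using isDyadic_int 1)).div_two
  rw [add_assoc, add_comm 1, ← digitParity_add_one_div_two hd h0 h1,
    ← hy _ h2 (by linarith) (by linarith)]
  congr 1; ring

theorem IsCone.digitParity_left {a b : ℝ} {c : ZMod 2} (h : IsCone a b c) :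
    digitParity a = c := by
  have := h.2.2 0 (by simpa using isDyadic_int 0) le_rfl one_pos
  simpa [digitParity_zero] using this

/-- The colors of the leaves of a tree whose root has the color `c`: a left child has the color
of its parent, and a right child the other color. -/
def leafColors : BinaryTree Unit → ZMod 2 → List (ZMod 2)
  | .nil, c => [c]
  | .node _ l r, c => leafColors l c ++ leafColors r (c + 1)

@[simp]
theorem length_leafColors (t : BinaryTree Unit) (c : ZMod 2) :
    (leafColors t c).length = t.numLeaves := by
  induction t generalizing c with
  | nil => rfl
  | node _ l r hl hr => simp [leafColors, hl, hr]

theorem IsCone.leaves (t : BinaryTree Unit) {a b : ℝ} {c : ZMod 2} (h : IsCone a b c) :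
    List.Forall₂ (fun I c => IsCone I.1 I.2 c) (leafIntervals t a b) (leafColors t c) := by
  induction t generalizing a b c with
  | nil => exact .cons h .nil
  | node _ l r hl hr => exact List.rel_append (hl h.leftHalf) (hr h.rightHalf)

/-- A map which is linear from one colored interval onto another changes the digit parity by the
difference of the two colors. -/
theorem LinOn.digitParity {f : UnitAddCircle → UnitAddCircle} {I J : ℝ × ℝ} {c d : ZMod 2}
    (h : LinOn f I J) (hI : IsCone I.1 I.2 c) (hJ : IsCone J.1 J.2 d) {s t : ℝ}
    (hs : IsDyadic s) (hsI : s ∈ Set.Ico I.1 I.2)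
    (hst : f (s : UnitAddCircle) = (t : UnitAddCircle)) :
    JonesThompson.digitParity t = JonesThompson.digitParity s + (d - c) := by
  have hlt := hI.lt
  obtain ⟨n, hn⟩ := coe_eq_coe_iff.1 (hst.symm.trans (h s hsI))
  set y := (s - I.1) / (I.2 - I.1) with hy
  have hI0 : (0 : ℝ) < I.2 - I.1 := by linarith
  have h0 : 0 ≤ y := div_nonneg (by linarith [hsI.1]) hI0.le
  have h1 : y < 1 := by rw [hy, div_lt_one hI0]; linarith [hsI.2]
  have hd : IsDyadic y := by
    obtain ⟨k, hk⟩ := hI.2.1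
    have := (hs.sub hI.1).zpow_mul (-k)
    rwa [zpow_neg, ← hk, inv_mul_eq_div] at this
  have e1 : s = I.1 + (I.2 - I.1) * y := by rw [hy]; field_simp; ring
  have e2 : J.1 + (J.2 - J.1) / (I.2 - I.1) * (s - I.1) = J.1 + (J.2 - J.1) * y := by
    rw [hy]; ring
  rw [hn, digitParity_add_int, e2, hJ.2.2 y hd h0 h1, e1, hI.2.2 y hd h0 h1]
  ring

/-! ### Elements of `T` which change all digit parities by the same amount -/

theorem IsDyadic.fract {s : ℝ} (hs : IsDyadic s) : IsDyadic (Int.fract s) :=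
  hs.sub (isDyadic_int _)

theorem coe_fract (s : ℝ) : ((Int.fract s : ℝ) : UnitAddCircle) = (s : UnitAddCircle) :=
  coe_eq_coe_iff.2 ⟨-⌊s⌋, by rw [Int.fract]; push_cast; ring⟩

theorem digitParity_fract (s : ℝ) : digitParity (Int.fract s) = digitParity s := by
  conv_rhs => rw [← Int.fract_add_floor s]
  rw [digitParity_add_int]

theorem isDyadic_of_map {f : UnitAddCircle ≃ₜ UnitAddCircle} (hf : f ∈ thompsonT) {s t : ℝ}
    (hs : IsDyadic s) (hst : f (s : UnitAddCircle) = (t : UnitAddCircle)) : IsDyadic t := by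
  obtain ⟨D, -, hf⟩ := hf
  obtain ⟨q, hsq, hq1, -, hq⟩ := exists_next D (Int.fract_lt_one s)
  obtain ⟨k, b, hb, h⟩ := hf _ q (Int.fract_nonneg s) hsq hq1 hq
  have h1 := h _ ⟨le_rfl, hsq.le⟩
  rw [coe_fract, hst] at h1
  obtain ⟨n, rfl⟩ := coe_eq_coe_iff.1 h1
  exact ((hs.fract.zpow_mul k).add hb).add (isDyadic_int n)

/-- The elements of `T` which either preserve or reverse the parity of the binary digits of all
dyadic points. -/
def parityGroup : Subgroup (UnitAddCircle ≃ₜ UnitAddCircle) where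
  carrier := {f | f ∈ thompsonT ∧ ∃ e : ZMod 2, ∀ s t : ℝ, IsDyadic s →
    f (s : UnitAddCircle) = (t : UnitAddCircle) → digitParity t = digitParity s + e}
  one_mem' := ⟨one_mem _, 0, fun s t _ h => by
    obtain ⟨n, rfl⟩ := coe_eq_coe_iff.1 (show (s : UnitAddCircle) = t from h)
    rw [digitParity_add_int, add_zero]⟩
  mul_mem' := by
    rintro f g ⟨hf, e, he⟩ ⟨hg, e', he'⟩
    refine ⟨mul_mem hf hg, e' + e, fun s t hs h => ?_⟩
    obtain ⟨u, -, -, hu⟩ := exists_rep (g (s : UnitAddCircle))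
    have h1 : f (g (s : UnitAddCircle)) = (t : UnitAddCircle) := h
    rw [← hu] at h1
    rw [he u t (isDyadic_of_map hg hs hu.symm) h1, he' s u hs hu.symm, add_assoc]
  inv_mem' := by
    rintro f ⟨hf, e, he⟩
    refine ⟨inv_mem hf, -e, fun s t hs h => ?_⟩
    have ht := isDyadic_of_map (inv_mem hf) hs h
    have h1 : f (t : UnitAddCircle) = (s : UnitAddCircle) := by
      rw [← h]; exact f.apply_symm_apply _
    rw [he t s ht h1]
    ring

theorem mem_parityGroup_of_Ico {f : UnitAddCircle ≃ₜ UnitAddCircle} (hf : f ∈ thompsonT)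
    (e : ZMod 2) (h : ∀ s t : ℝ, IsDyadic s → 0 ≤ s → s < 1 →
      f (s : UnitAddCircle) = (t : UnitAddCircle) → digitParity t = digitParity s + e) :
    f ∈ parityGroup := by
  refine ⟨hf, e, fun s t hs hst => ?_⟩
  rw [← digitParity_fract s]
  exact h _ t hs.fract (Int.fract_nonneg s) (Int.fract_lt_one s) (by rw [coe_fract, hst])

/-! ### The rotation -/

theorem rotHalf_coe (s : ℝ) :
    rotHalf (s : UnitAddCircle) = ((s + 1 / 2 : ℝ) : UnitAddCircle) := rfl

theorem rotHalf_mem_thompsonT : rotHalf ∈ thompsonT :=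
  ⟨∅, by simp, fun u v _ _ _ _ => ⟨0, 1 / 2, ⟨1, -1, by norm_num⟩, fun s _ => by
    rw [zpow_zero, one_mul]; rfl⟩⟩

theorem rotHalf_mem_parityGroup : rotHalf ∈ parityGroup := by
  refine mem_parityGroup_of_Ico rotHalf_mem_thompsonT 1 fun s t hs h0 h1 h => ?_
  obtain ⟨n, rfl⟩ := coe_eq_coe_iff.1 (h.symm.trans (rotHalf_coe s))
  rw [digitParity_add_int]
  have h2 : IsDyadic (2 * s) := by simpa using hs.zpow_mul 1
  rcases lt_or_ge s (1 / 2) with h3 | h3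
  · have e1 := digitParity_add_one_div_two h2 (by linarith) (by linarith)
    have e2 := digitParity_div_two (x := 2 * s) (by linarith) (by linarith)
    rw [show s + 1 / 2 = (2 * s + 1) / 2 by ring, e1, ← e2]
    congr 2; ring
  · have e1 := digitParity_add_one_div_two (h2.sub (by simpa using isDyadic_int 1))
      (x := 2 * s - 1) (by linarith) (by linarith)
    have e2 := digitParity_div_two (x := 2 * s - 1) (by linarith) (by linarith)
    rw [show s + 1 / 2 = (2 * s - 1) / 2 + (1 : ℤ) by push_cast; ring, digitParity_add_int, e2,
      show s = (2 * s - 1 + 1) / 2 by ring, e1,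
      show 2 * ((2 * s - 1 + 1) / 2) - 1 = 2 * s - 1 by ring, add_assoc]
    have : (1 : ZMod 2) + 1 = 0 := by decide
    rw [this, add_zero]

/-! ### The generators `xₙ` and the products `xₙ xₙ₊₁` -/

/-- The function `xₙ` on `[0,1]`, in terms of `d = 2⁻ⁿ`: the identity up to `1 - d` and a copy of
`x₀` on `[1 - d, 1]`. -/
noncomputable def xFun (d t : ℝ) : ℝ :=
  if t < 1 - d then t else if t < 1 - 3 * d / 4 then 2 * t - 1 + d
  else if t < 1 - d / 2 then t + d / 4 else t / 2 + 1 / 2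

theorem half_pow_pos (n : ℕ) : (0 : ℝ) < (1 / 2) ^ n := by positivity

theorem half_pow_le_one (n : ℕ) : ((1 : ℝ) / 2) ^ n ≤ 1 :=
  pow_le_one₀ (by norm_num) (by norm_num)

theorem coe_xIso (n : ℕ) (t : unitInterval) : (xIso n t : ℝ) = xFun ((1 / 2) ^ n) t := by
  induction n generalizing t with
  | zero =>
    have h0 := t.2.1
    show x0Fun t = _
    unfold x0Fun xFun
    split_ifs <;> linarith
  | succ n ih =>
    have hd := half_pow_pos n
    have hd' := half_pow_le_one n
    show (oplusFun _ _ t : ℝ) = _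
    unfold oplusFun
    rw [pow_succ]
    split_ifs with h
    · show (2 * (t : ℝ)) / 2 = _
      unfold xFun
      split_ifs <;> linarith
    · show ((xIso n _ : ℝ) + 1) / 2 = _
      rw [ih]
      unfold xFun
      dsimp only
      split_ifs <;> linarith

theorem xGen_coe (n : ℕ) {t : ℝ} (h0 : 0 ≤ t) (h1 : t ≤ 1) :
    xGen n (t : UnitAddCircle) = ((xFun ((1 / 2) ^ n) t : ℝ) : UnitAddCircle) := by
  have hd := half_pow_pos n
  have hd' := half_pow_le_one n
  have key : ∀ t : ℝ, 0 ≤ t → t < 1 →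
      xGen n (t : UnitAddCircle) = ((xFun ((1 / 2) ^ n) t : ℝ) : UnitAddCircle) := by
    intro t h0 h1
    show inducedMap _ _ = _
    rw [inducedMap_coe _ h0 h1, coe_xIso]
  rcases h1.lt_or_eq with h1 | rfl
  · exact key t h0 h1
  · have e0 : xFun ((1 / 2) ^ n) 0 = 0 := by unfold xFun; split_ifs <;> linarith
    have e1 : xFun ((1 / 2) ^ n) 1 = 1 := by unfold xFun; split_ifs <;> linarith
    have h : ((1 : ℝ) : UnitAddCircle) = ((0 : ℝ) : UnitAddCircle) :=
      coe_eq_coe_iff.2 ⟨1, by simp⟩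
    rw [e1, h, key 0 le_rfl one_pos, e0]

theorem isDyadic_half_pow (n : ℕ) : IsDyadic ((1 / 2 : ℝ) ^ n) :=
  ⟨1, -n, by rw [zpow_neg, zpow_natCast]; simp⟩

theorem xGen_mem_thompsonT (n : ℕ) : xGen n ∈ thompsonT := by
  have hd := half_pow_pos n
  have hd' := half_pow_le_one n
  have hD := isDyadic_half_pow n
  have hx := fun t => xGen_coe n (t := t)
  set d : ℝ := (1 / 2) ^ n with hdef
  have h1 : IsDyadic 1 := by simpa using isDyadic_int 1
  have h2 : IsDyadic (1 - d) := h1.sub hD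
  have h4 : IsDyadic (d / 4) := by
    have := hD.div_two.div_two
    rwa [div_div, show (2 : ℝ) * 2 = 4 by norm_num] at this
  have h5 : IsDyadic (1 - d / 2) := h1.sub hD.div_two
  have h6 : IsDyadic (1 - 3 * d / 4) := by
    have := h2.add h4
    rwa [show 1 - d + d / 4 = 1 - 3 * d / 4 by ring] at this
  refine ⟨{1 - d, 1 - 3 * d / 4, 1 - d / 2}, by simp [h2, h5, h6], ?_⟩
  intro u v hu huv hv hav
  have a1 := hav (1 - d) (by simp)
  have a2 := hav (1 - 3 * d / 4) (by simp)
  have a3 := hav (1 - d / 2) (by simp)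
  simp only [Set.mem_Ioo, not_and_or, not_lt] at a1 a2 a3
  have hx : ∀ k : ℤ, ∀ b : ℝ, IsDyadic b →
      (∀ s, u ≤ s → s ≤ v → xFun d s = 2 ^ k * s + b) → IsDyadicLinearOn (xGen n) u v :=
    fun k b hb h => ⟨k, b, hb, fun s hs => by
      rw [hx s (hu.trans hs.1) (hs.2.trans hv), h s hs.1 hs.2]⟩
  rcases a1 with a1 | a1
  · rcases a2 with a2 | a2
    · rcases a3 with a3 | a3
      · refine hx (-1) (1 / 2) h1.div_two fun s hs hs' => ?_
        rw [zpow_neg_one]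
        unfold xFun
        split_ifs <;> linarith
      · refine hx 0 (d / 4) h4 fun s hs hs' => ?_
        rw [zpow_zero]
        unfold xFun
        split_ifs <;> linarith
    · refine hx 1 (-(1 - d)) h2.neg fun s hs hs' => ?_
      rw [zpow_one]
      unfold xFun
      split_ifs <;> linarith
  · refine hx 0 0 (by simpa using isDyadic_int 0) fun s hs hs' => ?_
    rw [zpow_zero]
    unfold xFun
    split_ifs <;> linarith

/-- The product `xₙ xₙ₊₁`. -/
noncomputable def yGen (n : ℕ) : UnitAddCircle ≃ₜ UnitAddCircle := prodLR (xGen n) (xGen (n + 1))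

/-- The function `xₙ xₙ₊₁` on `[0,1]`, in terms of `d = 2⁻ⁿ`. -/
noncomputable def yFun (d t : ℝ) : ℝ :=
  if t < 1 - d then t else if t < 1 - 5 * d / 8 then 2 * t - 1 + d
  else if t < 1 - d / 2 then t + 3 * d / 8 else t / 4 + 3 / 4

theorem yFun_nonneg {d t : ℝ} (hd' : d ≤ 1) (h0 : 0 ≤ t) : 0 ≤ yFun d t := by
  unfold yFun; split_ifs <;> linarith

theorem yFun_lt_one {d t : ℝ} (hd : 0 < d) (h1 : t < 1) : yFun d t < 1 := by
  unfold yFun; split_ifs <;> linarith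

theorem yGen_coe (n : ℕ) {t : ℝ} (h0 : 0 ≤ t) (h1 : t < 1) :
    yGen n (t : UnitAddCircle) = ((yFun ((1 / 2) ^ n) t : ℝ) : UnitAddCircle) := by
  have hd := half_pow_pos n
  have hd' := half_pow_le_one n
  show xGen (n + 1) (xGen n _) = _
  rw [xGen_coe n h0 h1.le, xGen_coe (n + 1), pow_succ]
  · congr 1
    unfold xFun yFun
    split_ifs <;> linarith
  · unfold xFun
    split_ifs <;> linarith
  · unfold xFun
    split_ifs <;> linarith

theorem yFun_quarter (d t : ℝ) : yFun (d / 4) (t / 4 + 3 / 4) = yFun d t / 4 + 3 / 4 := by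
  unfold yFun
  split_ifs <;> linarith

theorem yFun_of_lt {d t : ℝ} (h : t < 1 - d) : yFun d t = t := if_pos h

theorem yFun_one_of_half_le {t : ℝ} (h : 1 / 2 ≤ t) : yFun 1 t = t / 4 + 3 / 4 := by
  unfold yFun
  split_ifs <;> linarith

theorem yFun_one_lt {t : ℝ} (h : t < 1 / 2) : yFun 1 t < 7 / 8 := by
  unfold yFun
  split_ifs <;> linarith

theorem half_le_yFun {d t : ℝ} (hd : d ≤ 1 / 2) (h : 1 / 2 ≤ t) : 1 / 2 ≤ yFun d t := by
  unfold yFun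
  split_ifs <;> linarith

/-- Conjugation by `x₀ x₁` shifts the indices of the later products by `2`. -/
theorem yGen_relation (n : ℕ) :
    (yGen (n + 1)).trans (yGen 0) = (yGen 0).trans (yGen (n + 3)) := by
  ext x
  obtain ⟨t, h0, h1, rfl⟩ := exists_rep x
  show yGen 0 (yGen (n + 1) _) = yGen (n + 3) (yGen 0 _)
  rw [yGen_coe _ h0 h1, yGen_coe _ h0 h1,
    yGen_coe _ (yFun_nonneg (half_pow_le_one _) h0) (yFun_lt_one (half_pow_pos _) h1),
    yGen_coe _ (yFun_nonneg (half_pow_le_one _) h0) (yFun_lt_one (half_pow_pos _) h1), pow_zero]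
  have hd : (1 / 2 : ℝ) ^ (n + 1) ≤ 1 / 2 := by
    rw [pow_succ]; linarith [half_pow_le_one n]
  have hd3 : (1 / 2 : ℝ) ^ (n + 3) = (1 / 2) ^ (n + 1) / 4 := by ring
  rw [hd3]
  rcases lt_or_ge t (1 / 2) with h | h
  · have h2 : yFun 1 t < 1 - (1 / 2) ^ (n + 1) / 4 := by linarith [yFun_one_lt h]
    rw [yFun_of_lt (d := (1 / 2) ^ (n + 1)) (t := t) (by linarith), yFun_of_lt h2]
  · rw [yFun_one_of_half_le h, yFun_quarter, yFun_one_of_half_le (half_le_yFun hd h)]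

theorem linOn_yGen {n : ℕ} {I J : ℝ × ℝ} (k : ℝ) (hk : J.2 - J.1 = k * (I.2 - I.1))
    (h0 : 0 ≤ I.1) (hI : I.1 < I.2) (h1 : I.2 ≤ 1)
    (h : ∀ s, I.1 ≤ s → s < I.2 → yFun ((1 / 2) ^ n) s = J.1 + k * (s - I.1)) :
    LinOn (yGen n) I J := by
  intro s hs
  have h2 : I.2 - I.1 ≠ 0 := by linarith
  rw [yGen_coe n (h0.trans hs.1) (hs.2.trans_le h1), h s hs.1 hs.2, hk, mul_div_cancel_right₀ _ h2]

/-- The product `xₙ xₙ₊₁` on the interval `[1 - 2⁻ⁿ, 1)`: in terms of binary prefixes behind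
`n` digits `1`, it maps `00, 010, 011, 1` to `0, 10, 110, 111`. -/
theorem linOn_yGen_cones (n : ℕ) : let d : ℝ := (1 / 2) ^ n
    LinOn (yGen n) (1 - d, 1 - 3 * d / 4) (1 - d, 1 - d / 2) ∧
    LinOn (yGen n) (1 - 3 * d / 4, 1 - 5 * d / 8) (1 - d / 2, 1 - d / 4) ∧
    LinOn (yGen n) (1 - 5 * d / 8, 1 - d / 2) (1 - d / 4, 1 - d / 8) ∧
    LinOn (yGen n) (1 - d / 2, 1) (1 - d / 8, 1) := by
  intro d
  have hd : 0 < d := half_pow_pos n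
  have hd' : d ≤ 1 := half_pow_le_one n
  refine ⟨linOn_yGen 2 ?_ ?_ ?_ ?_ ?_, linOn_yGen 2 ?_ ?_ ?_ ?_ ?_, linOn_yGen 1 ?_ ?_ ?_ ?_ ?_,
    linOn_yGen (1 / 4) ?_ ?_ ?_ ?_ ?_⟩ <;> dsimp only
  all_goals first
    | linarith
    | (intro s hs hs'
       change yFun d s = _
       unfold yFun
       split_ifs <;> linarith)

theorem linOn_yGen_left (n : ℕ) {I : ℝ × ℝ} (h0 : 0 ≤ I.1) (hI : I.1 < I.2)
    (h1 : I.2 ≤ 1 - (1 / 2) ^ n) : LinOn (yGen n) I I := by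
  have hd := half_pow_pos n
  refine linOn_yGen 1 (by ring) h0 hI (by linarith) fun s hs hs' => ?_
  unfold yFun
  split_ifs <;> linarith

theorem isCone_half_pow (n : ℕ) : IsCone (1 - (1 / 2) ^ n) 1 n := by
  induction n with
  | zero => simpa using isCone_zero_one
  | succ n ih =>
    have := ih.rightHalf
    rw [pow_succ, Nat.cast_succ]
    convert this using 1
    ring

theorem yGen_mem_parityGroup (n : ℕ) : yGen n ∈ parityGroup := by
  have hT : yGen n ∈ thompsonT := mul_mem (xGen_mem_thompsonT (n + 1)) (xGen_mem_thompsonT n)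
  refine mem_parityGroup_of_Ico hT 0 fun s t hs h0 h1 h => ?_
  obtain ⟨l1, l2, l3, l4⟩ := linOn_yGen_cones n
  have hc := isCone_half_pow n
  have hy := yGen_coe n h0 h1
  set d : ℝ := (1 / 2) ^ n with hd
  have hd0 : 0 < d := half_pow_pos n
  have two : (1 : ZMod 2) + 1 = 0 := by decide
  have c0 : IsCone (1 - d) (1 - d / 2) n := by convert hc.leftHalf using 1; ring
  have c1 : IsCone (1 - d / 2) 1 (n + 1) := by convert hc.rightHalf using 1; ring
  have c00 : IsCone (1 - d) (1 - 3 * d / 4) n := by convert c0.leftHalf using 1; ring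
  have c01 : IsCone (1 - 3 * d / 4) (1 - d / 2) (n + 1) := by
    convert c0.rightHalf using 1; ring
  have c010 : IsCone (1 - 3 * d / 4) (1 - 5 * d / 8) (n + 1) := by
    convert c01.leftHalf using 1; ring
  have c011 : IsCone (1 - 5 * d / 8) (1 - d / 2) n := by
    convert c01.rightHalf using 1
    · ring
    · rw [add_assoc, two, add_zero]
  have c10 : IsCone (1 - d / 2) (1 - d / 4) (n + 1) := by convert c1.leftHalf using 1; ring
  have c11 : IsCone (1 - d / 4) 1 n := by
    convert c1.rightHalf using 1
    · ring
    · rw [add_assoc, two, add_zero]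
  have c110 : IsCone (1 - d / 4) (1 - d / 8) n := by convert c11.leftHalf using 1; ring
  have c111 : IsCone (1 - d / 8) 1 (n + 1) := by convert c11.rightHalf using 1; ring
  rcases lt_or_ge s (1 - d) with h2 | h2
  · obtain ⟨m, rfl⟩ := coe_eq_coe_iff.1 (h.symm.trans hy)
    rw [digitParity_add_int, yFun, if_pos h2, add_zero]
  rcases lt_or_ge s (1 - 3 * d / 4) with h3 | h3
  · rw [l1.digitParity c00 c0 hs ⟨h2, h3⟩ h, sub_self]
  rcases lt_or_ge s (1 - 5 * d / 8) with h4 | h4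
  · rw [l2.digitParity c010 c10 hs ⟨h3, h4⟩ h, sub_self]
  rcases lt_or_ge s (1 - d / 2) with h5 | h5
  · rw [l3.digitParity c011 c110 hs ⟨h4, h5⟩ h, sub_self]
  · rw [l4.digitParity c1 c111 hs ⟨h5, h1⟩ h, sub_self]

/-! ### Bipartite Thompson graphs -/

/-- The color of the leaf number `i` of a tree whose root has the color `c`. -/
def leafColor (t : BinaryTree Unit) (c : ZMod 2) (i : ℕ) : ZMod 2 := (leafColors t c).getD i 0

theorem leafColor_node_left {l r : BinaryTree Unit} {c : ZMod 2} {i : ℕ} (h : i < l.numLeaves) :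
    leafColor (.node () l r) c i = leafColor l c i :=
  List.getD_append _ _ _ _ (by simpa using h)

theorem leafColor_node_right {l r : BinaryTree Unit} {c : ZMod 2} {i : ℕ} :
    leafColor (.node () l r) c (l.numLeaves + i) = leafColor r (c + 1) i := by
  have := List.getD_append_right (leafColors l c) (leafColors r (c + 1)) 0 (l.numLeaves + i)
    (by simp)
  rw [length_leafColors, Nat.add_sub_cancel_left] at this
  exact this

theorem leafColor_zero (t : BinaryTree Unit) (c : ZMod 2) : leafColor t c 0 = c := by
  induction t generalizing c with
  | nil => rfl
  | node _ l r hl _ => rw [leafColor_node_left l.numLeaves_pos, hl]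

theorem leafColor_eq_add (t : BinaryTree Unit) (c : ZMod 2) {i : ℕ} (hi : i < t.numLeaves) :
    leafColor t c i = c + leafColor t 0 i := by
  induction t generalizing c i with
  | nil =>
    obtain rfl : i = 0 := by simpa using hi
    rw [leafColor_zero, leafColor_zero, add_zero]
  | node _ l r hl hr =>
    rcases lt_or_ge i l.numLeaves with h | h
    · rw [leafColor_node_left h, leafColor_node_left h, hl c h]
    · obtain ⟨j, rfl⟩ := Nat.exists_eq_add_of_le h
      have hj : j < r.numLeaves := by simpa using hi
      rw [leafColor_node_right, leafColor_node_right, hr (c + 1) hj, hr (0 + 1) hj]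
      ring

theorem ThompsonEdge.lt {t : BinaryTree Unit} {i j : ℕ} (h : ThompsonEdge t i j) :
    i < t.numLeaves ∧ j < t.numLeaves := by
  induction h with
  | @root l r =>
    have := l.numLeaves_pos
    have := r.numLeaves_pos
    simp only [BinaryTree.numLeaves]; omega
  | left _ ih => simp only [BinaryTree.numLeaves]; omega
  | right _ ih => simp only [BinaryTree.numLeaves]; omega

/-- The two vertices of an edge of the Thompson graph of a tree have different colors. -/
theorem ThompsonEdge.leafColor {t : BinaryTree Unit} {i j : ℕ} (h : ThompsonEdge t i j)
    (c : ZMod 2) :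
    JonesThompson.leafColor t c j = JonesThompson.leafColor t c i + 1 := by
  induction h generalizing c with
  | @root l r =>
    have := leafColor_node_right (l := l) (r := r) (c := c) (i := 0)
    rw [add_zero] at this
    rw [this, leafColor_zero, leafColor_zero]
  | left h ih => rw [leafColor_node_left h.lt.1, leafColor_node_left h.lt.2, ih]
  | right h ih => rw [leafColor_node_right, leafColor_node_right, ih]

/-- The Thompson graph of a tree is connected: a proper coloring is determined by the color of the
first vertex. -/
theorem eq_leafColor_of_edges (t : BinaryTree Unit) (C : ℕ → ZMod 2)
    (hC : ∀ i j, ThompsonEdge t i j → C j = C i + 1) {i : ℕ} (hi : i < t.numLeaves) :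
    C i = leafColor t (C 0) i := by
  induction t generalizing C i with
  | nil =>
    obtain rfl : i = 0 := by simpa using hi
    rw [leafColor_zero]
  | node _ l r hl hr =>
    rcases lt_or_ge i l.numLeaves with h | h
    · rw [leafColor_node_left h]
      exact hl C (fun i j hij => hC i j hij.left) h
    · obtain ⟨j, rfl⟩ := Nat.exists_eq_add_of_le h
      have := hr (fun j => C (l.numLeaves + j)) (fun i j hij => hC _ _ hij.right)
        (i := j) (by simpa using hi)
      rw [leafColor_node_right, this, add_zero, hC _ _ .root]

theorem TreePair.glue_val (P : TreePair) (i : Fin P.input.numLeaves) :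
    (P.glue i : ℕ) = if (i : ℕ) + P.shift < P.input.numLeaves then (i : ℕ) + P.shift
      else i + P.shift - P.input.numLeaves := by
  have h1 := i.2
  have h2 := P.shift.2
  show ((i : ℕ) + P.shift) % P.input.numLeaves = _
  split_ifs with h
  · exact Nat.mod_eq_of_lt h
  · rw [Nat.mod_eq_sub_mod (not_lt.1 h), Nat.mod_eq_of_lt (by omega)]

theorem TreePair.glue_bijective (P : TreePair) : Function.Bijective P.glue := by
  refine (Fintype.bijective_iff_injective_and_card _).2 ⟨fun i j h => ?_, ?_⟩
  · have h' : (P.glue i : ℕ) = P.glue j := by rw [h]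
    have h1 := i.2
    have h2 := j.2
    rw [glue_val, glue_val] at h'
    apply Fin.ext
    split_ifs at h' <;> omega
  · rw [Fintype.card_fin, Fintype.card_fin, P.numLeaves_eq]

/-- A proper coloring of the Thompson graph of a tree agrees with the coloring of the leaves up to a
constant. -/
theorem exists_leafColor_of_coloring {t : BinaryTree Unit} (C : Fin t.numLeaves → ZMod 2)
    (hC : ∀ i j, (treeGraph t).Adj i j → C i ≠ C j) :
    ∃ e, ∀ i : Fin t.numLeaves, C i = e + leafColor t 0 i := by
  have two : ∀ a b : ZMod 2, b ≠ a → a = b + 1 := by decide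
  let C' : ℕ → ZMod 2 := fun i => if h : i < t.numLeaves then C ⟨i, h⟩ else 0
  refine ⟨C' 0, fun i => ?_⟩
  have h1 : C' i = C i := dif_pos i.2
  rw [← h1, ← leafColor_eq_add t _ i.2]
  refine eq_leafColor_of_edges t C' (fun i j hij => ?_) i.2
  have hi : C' i = C ⟨i, hij.lt.1⟩ := dif_pos hij.lt.1
  have hj : C' j = C ⟨j, hij.lt.2⟩ := dif_pos hij.lt.2
  rw [hi, hj]
  refine two _ _ (hC _ _ ((SimpleGraph.fromRel_adj _ _ _).2 ⟨fun h => ?_, Or.inl hij⟩))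
  have h2 := hij.leafColor 0
  rw [show i = j from congrArg Fin.val h] at h2
  simp at h2

theorem leafColor_ne_of_adj {t : BinaryTree Unit} {i j : Fin t.numLeaves}
    (h : (treeGraph t).Adj i j) : leafColor t 0 i ≠ leafColor t 0 j := by
  obtain ⟨-, h | h⟩ := (SimpleGraph.fromRel_adj _ _ _).1 h <;> rw [h.leafColor] <;> simp

/-- As the Thompson graphs of both trees are connected, the Thompson graph of a pair of trees is
bipartite if and only if the colors of the leaves of the two trees either all agree or all
differ. -/
theorem TreePair.isBipartite_iff (P : TreePair) : P.thompsonGraph.IsBipartite ↔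
    ∃ e, ∀ i, leafColor P.output 0 (P.glue i) = leafColor P.input 0 i + e := by
  constructor
  · rintro ⟨C⟩
    let C' : Fin P.input.numLeaves → ZMod 2 := C
    have hC' : ∀ i j, P.thompsonGraph.Adj i j → C' i ≠ C' j := fun i j h => C.valid h
    obtain ⟨g, -, hg⟩ := Function.bijective_iff_has_inverse.1 P.glue_bijective
    obtain ⟨e, he⟩ := exists_leafColor_of_coloring C' fun i j h => hC' i j (Or.inl h)
    obtain ⟨e', he'⟩ := exists_leafColor_of_coloring (fun i => C' (g i)) fun i j h =>
      hC' _ _ (Or.inr (by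
        show (treeGraph P.output).Adj (P.glue (g i)) (P.glue (g j))
        rwa [hg, hg]))
    refine ⟨e - e', fun i => ?_⟩
    obtain ⟨j, rfl⟩ : ∃ j, g j = i :=
      ⟨P.glue i, P.glue_bijective.1 (hg _)⟩
    have h1 := he (g j)
    have h2 := he' j
    rw [hg]
    linear_combination h1 - h2
  · rintro ⟨e, he⟩
    let C : Fin P.input.numLeaves → Fin 2 := fun i => leafColor P.input 0 i
    refine ⟨SimpleGraph.Coloring.mk C fun {i j} h => ?_⟩
    rcases h with h | h
    · exact leafColor_ne_of_adj h
    · have h1 := leafColor_ne_of_adj (show (treeGraph P.output).Adj _ _ from h)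
      rw [he, he] at h1
      exact fun h2 => h1 (congrArg (· + e) h2)

theorem leafInterval_mem (t : BinaryTree Unit) (i : Fin t.numLeaves) :
    leafInterval t i ∈ leafIntervals t 0 1 := List.get_mem _ _

theorem isCone_leafInterval (t : BinaryTree Unit) (i : Fin t.numLeaves) :
    IsCone (leafInterval t i).1 (leafInterval t i).2 (leafColor t 0 i) := by
  have h := (List.forall₂_iff_get.1 (isCone_zero_one.leaves t)).2 i
    (by rw [length_leafIntervals]; exact i.2) (by rw [length_leafColors]; exact i.2)
  rw [leafColor, List.getD_eq_getElem _ _ (by rw [length_leafColors]; exact i.2)]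
  exact h

/-- The Thompson graph of a pair of trees, reduced or not, which represents an element of `T` is
bipartite if and only if this element changes all digit parities by the same amount. -/
theorem TreePair.Represents.isBipartite_iff {P : TreePair} {f : UnitAddCircle ≃ₜ UnitAddCircle}
    (hP : P.Represents f) (hf : f ∈ thompsonT) :
    P.thompsonGraph.IsBipartite ↔ f ∈ parityGroup := by
  have hP : ∀ i, LinOn f (leafInterval P.input i) (leafInterval P.output (P.glue i)) := hP
  rw [P.isBipartite_iff]
  constructor
  · rintro ⟨e, he⟩
    refine mem_parityGroup_of_Ico hf e fun s t hs h0 h1 hst => ?_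
    obtain ⟨I, hI, hsI⟩ := exists_mem_leafIntervals P.input (a := 0) (b := 1) ⟨h0, h1⟩
    obtain ⟨i, hi, rfl⟩ := List.getElem_of_mem hI
    rw [length_leafIntervals] at hi
    rw [(hP ⟨i, hi⟩).digitParity (isCone_leafInterval _ _) (isCone_leafInterval _ _) hs hsI hst,
      he, add_sub_cancel_left]
  · rintro ⟨-, e, he⟩
    refine ⟨e, fun i => ?_⟩
    have hI := isCone_leafInterval P.input i
    rw [← (isCone_leafInterval P.output (P.glue i)).digitParity_left, ← hI.digitParity_left]
    exact he _ _ hI.1 ((hP i).map_left hI.lt)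

/-! ### Reduction of pairs of trees -/

/-- An exposed caret can be removed from a tree. -/
theorem IsExposedCaret.exists_collapse {t : BinaryTree Unit} {i : ℕ} (h : IsExposedCaret t i) :
    ∃ t' : BinaryTree Unit, t.numLeaves = t'.numLeaves + 1 ∧ i < t'.numLeaves ∧
      ∀ a b : ℝ, ∃ (L M : List (ℝ × ℝ)) (c d : ℝ), L.length = i ∧
        leafIntervals t' a b = L ++ (c, d) :: M ∧
        leafIntervals t a b = L ++ (c, (c + d) / 2) :: ((c + d) / 2, d) :: M := by
  induction h with
  | root => exact ⟨.nil, rfl, by simp, fun a b => ⟨[], [], a, b, rfl, rfl, rfl⟩⟩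
  | @left l r i _ ih =>
    obtain ⟨t', h1, h2, h3⟩ := ih
    refine ⟨.node () t' r, by simp only [BinaryTree.numLeaves]; omega,
      by simp only [BinaryTree.numLeaves]; omega, fun a b => ?_⟩
    obtain ⟨L, M, c, d, h4, h5, h6⟩ := h3 a ((a + b) / 2)
    exact ⟨L, M ++ leafIntervals r ((a + b) / 2) b, c, d, h4, by simp [leafIntervals, h5],
      by simp [leafIntervals, h6]⟩
  | @right l r i _ ih =>
    obtain ⟨t', h1, h2, h3⟩ := ih
    refine ⟨.node () l t', by simp only [BinaryTree.numLeaves]; omega,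
      by simp only [BinaryTree.numLeaves]; omega, fun a b => ?_⟩
    obtain ⟨L, M, c, d, h4, h5, h6⟩ := h3 ((a + b) / 2) b
    exact ⟨leafIntervals l a ((a + b) / 2) ++ L, M, c, d,
      by simp [length_leafIntervals, h4], by simp [leafIntervals, h5],
      by simp [leafIntervals, h6]⟩

theorem leafInterval_eq_getElem? (t : BinaryTree Unit) (i : Fin t.numLeaves) :
    (leafIntervals t 0 1)[(i : ℕ)]? = some (leafInterval t i) :=
  List.getElem?_eq_getElem _

/-- A pair of trees represents `f` if and only if `f` maps the entries of the first list of
intervals to the cyclically corresponding entries of the second one. -/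
theorem TreePair.represents_iff (P : TreePair) (f : UnitAddCircle → UnitAddCircle) :
    P.Represents f ↔ ∀ (q : ℕ) (I J : ℝ × ℝ), q < P.input.numLeaves →
      (leafIntervals P.input 0 1)[q]? = some I →
      (leafIntervals P.output 0 1)[if q + P.shift.val < P.input.numLeaves then q + P.shift.val
        else q + P.shift.val - P.input.numLeaves]? = some J → LinOn f I J := by
  constructor
  · intro h q I J hq hI hJ
    rw [← P.glue_val ⟨q, hq⟩, leafInterval_eq_getElem?, Option.some_inj] at hJ
    rw [leafInterval_eq_getElem? _ ⟨q, hq⟩, Option.some_inj] at hI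
    rw [← hI, ← hJ]
    exact h ⟨q, hq⟩
  · intro h i
    exact h i _ _ i.2 (leafInterval_eq_getElem? _ _)
      (by rw [← P.glue_val]; exact leafInterval_eq_getElem? _ _)

theorem getElem?_collapse {α : Type*} (L M : List α) (x y z : α) (p : ℕ) :
    (L ++ x :: M)[p]? = if p < L.length then (L ++ y :: z :: M)[p]? else
      if p = L.length then some x else (L ++ y :: z :: M)[p + 1]? := by
  split_ifs with h1 h2
  · rw [List.getElem?_append_left h1, List.getElem?_append_left h1]
  · simp [h2]
  · obtain ⟨q, rfl⟩ : ∃ q, p = L.length + (q + 1) := ⟨p - L.length - 1, by omega⟩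
    rw [List.getElem?_append_right (by omega), List.getElem?_append_right (by omega)]
    simp [show L.length + (q + 1) + 1 - L.length = q + 2 by omega]

/-- Removing a dipole from a pair of trees. -/
theorem TreePair.Represents.exists_smaller {P : TreePair} {f : UnitAddCircle → UnitAddCircle}
    (hP : P.Represents f) (h : ¬ P.IsReduced) :
    ∃ Q : TreePair, Q.Represents f ∧ Q.input.numLeaves < P.input.numLeaves := by
  obtain ⟨i, i', hii, hg, hR, hS⟩ := not_not.1 h
  obtain ⟨R, hR1, hR2, hR3⟩ := hR.exists_collapse
  obtain ⟨S, hS1, hS2, hS3⟩ := hS.exists_collapse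
  have hPn := P.numLeaves_eq
  have hk := P.shift.2
  have hi'2 := i'.2
  rw [P.glue_val, P.glue_val] at hg
  have hgi := P.glue_val i
  set k : ℕ := P.shift.val
  -- If the dipole is not moved across the right end, the shift remains the same; otherwise it
  -- decreases by `1`, as one leaf to the left of the partner of the first leaf is lost.
  obtain ⟨m, hm⟩ : ∃ m, m = if (i : ℕ) + k < P.input.numLeaves then k else k - 1 := ⟨_, rfl⟩
  obtain ⟨g, hg'⟩ : ∃ g, g = (P.glue i : ℕ) := ⟨_, rfl⟩
  rw [← hg'] at hS2 hS3 hgi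
  rw [← hgi] at hg
  have hmg : ((i : ℕ) + k + 1 < P.input.numLeaves ∧ g = i + k ∧ m = k) ∨
      (P.input.numLeaves ≤ i + k ∧ g = i + k - P.input.numLeaves ∧ m + 1 = k) := by
    rw [hii] at hg
    clear hR3 hS3
    split_ifs at hg hm hgi <;> omega
  have hmR : m < R.numLeaves := by omega
  refine ⟨⟨R, S, by omega, ⟨m, hmR⟩⟩, ?_, by show R.numLeaves < _; omega⟩
  rw [TreePair.represents_iff] at hP ⊢
  intro p I J hp hI hJ
  have hp : p < R.numLeaves := hp
  have hI : (leafIntervals R 0 1)[p]? = some I := hI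
  have hJ : (leafIntervals S 0 1)[if p + m < R.numLeaves then p + m
    else p + m - R.numLeaves]? = some J := hJ
  change ∀ (q : ℕ) (I J : ℝ × ℝ), q < P.input.numLeaves →
      (leafIntervals P.input 0 1)[q]? = some I →
      (leafIntervals P.output 0 1)[if q + k < P.input.numLeaves then q + k
        else q + k - P.input.numLeaves]? = some J → LinOn f I J at hP
  obtain ⟨L, M, a, b, hL, hLM, hLM'⟩ := hR3 0 1
  obtain ⟨L', M', c, d, hL', hLM₂, hLM₂'⟩ := hS3 0 1
  have hab : a < b := leafIntervals_pos R one_pos (a, b) (by rw [hLM]; simp)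
  rw [hLM, getElem?_collapse L M _ (a, (a + b) / 2) ((a + b) / 2, b), ← hLM', hL] at hI
  rw [hLM₂, getElem?_collapse L' M' _ (c, (c + d) / 2) ((c + d) / 2, d), ← hLM₂', hL'] at hJ
  clear hR3 hS3 hLM hLM₂ hR hS h
  obtain ⟨r, hr⟩ : ∃ r, r = if p + m < R.numLeaves then p + m else p + m - R.numLeaves := ⟨_, rfl⟩
  rw [← hr] at hJ
  have hr' : (p + m < R.numLeaves ∧ r = p + m) ∨
      (R.numLeaves ≤ p + m ∧ r = p + m - R.numLeaves) := by
    split_ifs at hr <;> omega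
  have key : ∀ (q j : ℕ), q < P.input.numLeaves →
      (j = if q + k < P.input.numLeaves then q + k else q + k - P.input.numLeaves) →
      (leafIntervals P.input 0 1)[q]? = some I → (leafIntervals P.output 0 1)[j]? = some J →
      LinOn f I J := by
    intro q j hq hj hI hJ
    exact hP q I J hq hI (by rw [← hj, hJ])
  -- Leaves to the right of the collapsed one have moved by one place, in each of the two trees.
  rcases lt_trichotomy p i with h1 | h1 | h1
  · rw [if_pos h1] at hI
    split_ifs at hJ with h2 h3
    · exact key _ _ (by omega) (by split_ifs <;> omega) hI hJ
    · exfalso; omega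
    · exact key _ _ (by omega) (by split_ifs <;> omega) hI hJ
  · rw [if_neg (by omega), if_pos h1, Option.some_inj] at hI
    have e : r = g := by omega
    rw [if_neg (by omega), if_pos e, Option.some_inj] at hJ
    rw [← hI, ← hJ]
    refine LinOn.of_halves ?_ ?_ hab
    · refine hP i _ _ i.2 ?_ ?_
      · rw [hLM', ← hL]; simp
      · rw [← hgi, hLM₂', ← hL']; simp
    · refine hP i' _ _ hi'2 ?_ ?_
      · rw [hLM', hii, ← hL]; simp
      · rw [hg, hLM₂', ← hL']; simp
  · rw [if_neg (by omega), if_neg (by omega)] at hI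
    split_ifs at hJ with h2 h3
    · exact key _ _ (by omega) (by split_ifs <;> omega) hI hJ
    · exfalso; omega
    · exact key _ _ (by omega) (by split_ifs <;> omega) hI hJ

theorem TreePair.Represents.exists_reduced {f : UnitAddCircle → UnitAddCircle} {P : TreePair}
    (hP : P.Represents f) : ∃ Q : TreePair, Q.Represents f ∧ Q.IsReduced := by
  induction hn : P.input.numLeaves using Nat.strong_induction_on generalizing P with
  | _ n ih =>
    by_cases h : P.IsReduced
    · exact ⟨P, hP, h⟩
    · obtain ⟨Q, hQ, hlt⟩ := hP.exists_smaller h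
      exact ih _ (hn ▸ hlt) hQ rfl

/-! ### Elements of `T` are represented by pairs of trees -/

/-- The intervals of a list, in their order, fit together to the interval from `a` to `b`. -/
def Tiles : ℝ → List (ℝ × ℝ) → ℝ → Prop
  | a, [], b => a = b
  | a, I :: L, b => I.1 = a ∧ Tiles I.2 L b

theorem tiles_append {a b : ℝ} {L M : List (ℝ × ℝ)} :
    Tiles a (L ++ M) b ↔ ∃ c, Tiles a L c ∧ Tiles c M b := by
  induction L generalizing a with
  | nil => simp [Tiles]
  | cons I L ih =>
    simp only [List.cons_append, Tiles, ih]
    exact ⟨fun ⟨h, c, h1, h2⟩ => ⟨c, ⟨h, h1⟩, h2⟩, fun ⟨c, ⟨h, h1⟩, h2⟩ => ⟨h, c, h1, h2⟩⟩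

theorem Tiles.le {a b : ℝ} {L : List (ℝ × ℝ)} (h : Tiles a L b) (hL : ∀ I ∈ L, I.1 < I.2) :
    a ≤ b := by
  induction L generalizing a with
  | nil => exact le_of_eq h
  | cons I L ih =>
    have := ih h.2 fun J hJ => hL J (by simp [hJ])
    have := hL I (by simp)
    linarith [h.1]

theorem Tiles.eq_nil {a : ℝ} {L : List (ℝ × ℝ)} (h : Tiles a L a) (hL : ∀ I ∈ L, I.1 < I.2) :
    L = [] := by
  cases L with
  | nil => rfl
  | cons I L =>
    have := h.2.le fun J hJ => hL J (by simp [hJ])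
    have := hL I (by simp)
    linarith [h.1]

/-- A list of intervals which fit together can be split at every point which is not in the
interior of one of them. -/
theorem Tiles.split {a b c : ℝ} {L : List (ℝ × ℝ)} (h : Tiles a L b) (hac : a ≤ c) (hcb : c ≤ b)
    (hc : ∀ I ∈ L, c ∉ Set.Ioo I.1 I.2) :
    ∃ L₁ L₂, L = L₁ ++ L₂ ∧ Tiles a L₁ c ∧ Tiles c L₂ b := by
  induction L generalizing a with
  | nil => exact ⟨[], [], rfl, le_antisymm hac (hcb.trans_eq (Eq.symm h)), le_antisymm hcb (by
      rw [← show a = b from h]; exact hac)⟩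
  | cons I L ih =>
    rcases hac.eq_or_lt with rfl | hlt
    · exact ⟨[], I :: L, rfl, rfl, h⟩
    · have h1 : I.2 ≤ c := by
        by_contra hcon
        exact hc I (by simp) ⟨h.1.trans_lt hlt, not_le.1 hcon⟩
      obtain ⟨L₁, L₂, rfl, h2, h3⟩ := ih h.2 h1 fun J hJ => hc J (by simp [hJ])
      exact ⟨I :: L₁, L₂, rfl, ⟨h.1, h2⟩, h3⟩

theorem tiles_map_range (g : ℕ → ℝ × ℝ) (x : ℕ → ℝ) (K : ℕ)
    (h : ∀ p < K, (g p).1 = x p ∧ (g p).2 = x (p + 1)) :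
    Tiles (x 0) ((List.range K).map g) (x K) := by
  induction K with
  | zero => rfl
  | succ K ih =>
    rw [List.range_succ, List.map_append, tiles_append]
    refine ⟨x K, ih fun p hp => h p (by omega), ?_⟩
    exact ⟨(h K (by omega)).1, (h K (by omega)).2⟩

/-- The dyadic interval from `k / 2ⁿ` to `(k + 1) / 2ⁿ`. -/
noncomputable def dyadicInterval (n : ℕ) (k : ℤ) : ℝ × ℝ := (k / 2 ^ n, (k + 1) / 2 ^ n)

theorem dyadicInterval_length (n : ℕ) (k : ℤ) :
    (dyadicInterval n k).2 - (dyadicInterval n k).1 = 1 / 2 ^ n := by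
  simp only [dyadicInterval]; ring

theorem dyadicInterval_lt (n : ℕ) (k : ℤ) : (dyadicInterval n k).1 < (dyadicInterval n k).2 := by
  have := dyadicInterval_length n k
  have : (0 : ℝ) < 1 / 2 ^ n := by positivity
  linarith

theorem Tiles.eq_singleton {a b : ℝ} {L : List (ℝ × ℝ)} (h : Tiles a L b)
    (hL : ∀ I ∈ L, I.1 < I.2) {J : ℝ × ℝ} (hJ : J ∈ L) (hab : b - a ≤ J.2 - J.1) :
    L = [(a, b)] := by
  obtain ⟨L₁, L₂, rfl⟩ := List.append_of_mem hJ
  obtain ⟨c, h1, rfl, h2⟩ := tiles_append.1 h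
  have p1 : ∀ I ∈ L₁, I.1 < I.2 := fun I hI => hL I (by simp [hI])
  have p2 : ∀ I ∈ L₂, I.1 < I.2 := fun I hI => hL I (by simp [hI])
  have l1 := h1.le p1
  have l2 := h2.le p2
  obtain rfl : a = J.1 := by linarith
  obtain rfl : b = J.2 := by linarith
  rw [h1.eq_nil p1, h2.eq_nil p2]
  rfl

/-- Dyadic intervals which fit together to a dyadic interval are the intervals of the leaves of a
tree: if there are at least two of them, then the middle of the large interval is in the interior
of none of the small ones. -/
theorem exists_leafIntervals_eq (e n : ℕ) (k : ℤ) (L : List (ℝ × ℝ))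
    (hT : Tiles (dyadicInterval n k).1 L (dyadicInterval n k).2)
    (hL : ∀ I ∈ L, ∃ (n' : ℕ) (k' : ℤ), n' ≤ n + e ∧ I = dyadicInterval n' k') :
    ∃ t, leafIntervals t (dyadicInterval n k).1 (dyadicInterval n k).2 = L := by
  induction e generalizing n k L with
  | zero =>
    have hpos : ∀ I ∈ L, I.1 < I.2 := fun I hI => by
      obtain ⟨n', k', -, rfl⟩ := hL I hI; exact dyadicInterval_lt _ _
    cases L with
    | nil => exact absurd hT (dyadicInterval_lt n k).ne
    | cons J L =>
      obtain ⟨n', k', hn', rfl⟩ := hL J (by simp)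
      refine ⟨.nil, (hT.eq_singleton hpos List.mem_cons_self ?_).symm⟩
      rw [dyadicInterval_length, dyadicInterval_length]
      exact one_div_le_one_div_of_le (by positivity) (pow_le_pow_right₀ one_le_two hn')
  | succ e ih =>
    have hpos : ∀ I ∈ L, I.1 < I.2 := fun I hI => by
      obtain ⟨n', k', -, rfl⟩ := hL I hI; exact dyadicInterval_lt _ _
    by_cases hex : ∃ n' k', n' ≤ n ∧ dyadicInterval n' k' ∈ L
    · obtain ⟨n', k', hn', hJ⟩ := hex
      refine ⟨.nil, (hT.eq_singleton hpos hJ ?_).symm⟩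
      rw [dyadicInterval_length, dyadicInterval_length]
      exact one_div_le_one_div_of_le (by positivity) (pow_le_pow_right₀ one_le_two hn')
    have hlt := dyadicInterval_lt n k
    have e1 : (dyadicInterval (n + 1) (2 * k)).1 = (dyadicInterval n k).1 := by
      simp only [dyadicInterval]; push_cast; field_simp; ring
    have e2 : (dyadicInterval (n + 1) (2 * k)).2 =
        ((dyadicInterval n k).1 + (dyadicInterval n k).2) / 2 := by
      simp only [dyadicInterval]; push_cast; field_simp; ring
    have e3 : (dyadicInterval (n + 1) (2 * k + 1)).1 =
        ((dyadicInterval n k).1 + (dyadicInterval n k).2) / 2 := by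
      simp only [dyadicInterval]; push_cast; field_simp; ring
    have e4 : (dyadicInterval (n + 1) (2 * k + 1)).2 = (dyadicInterval n k).2 := by
      simp only [dyadicInterval]; push_cast; field_simp; ring
    obtain ⟨L₁, L₂, rfl, h1, h2⟩ := hT.split (c := (dyadicInterval (n + 1) (2 * k + 1)).1)
      (by rw [e3]; linarith) (by rw [e3]; linarith) (by
        intro I hI hc
        obtain ⟨n', k', -, rfl⟩ := hL I hI
        have hn' : n + 1 ≤ n' := by
          by_contra hcon
          exact hex ⟨n', k', by omega, hI⟩
        obtain ⟨j, rfl⟩ := Nat.exists_eq_add_of_le hn'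
        simp only [dyadicInterval, Set.mem_Ioo] at hc
        rw [pow_add 2 (n + 1) j, div_lt_div_iff₀ (by positivity) (by positivity),
          div_lt_div_iff₀ (by positivity) (by positivity)] at hc
        obtain ⟨h1, h2⟩ := hc
        have hp : (0 : ℝ) < 2 ^ (n + 1) := by positivity
        have h1' : (k' : ℝ) < ((2 * k + 1 : ℤ) : ℝ) * 2 ^ j := by
          refine lt_of_mul_lt_mul_right ?_ hp.le
          linarith
        have h2' : ((2 * k + 1 : ℤ) : ℝ) * 2 ^ j < (k' : ℝ) + 1 := by
          refine lt_of_mul_lt_mul_right ?_ hp.le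
          linarith
        have h1'' : k' < (2 * k + 1) * 2 ^ j := by exact_mod_cast h1'
        have h2'' : (2 * k + 1) * 2 ^ j < k' + 1 := by exact_mod_cast h2'
        omega)
    have key : ∀ I ∈ L₁ ++ L₂, ∃ (n' : ℕ) (k' : ℤ), n' ≤ n + 1 + e ∧ I = dyadicInterval n' k' := by
      intro I hI
      obtain ⟨n', k', h, rfl⟩ := hL I hI
      exact ⟨n', k', by omega, rfl⟩
    obtain ⟨t₁, ht₁⟩ := ih (n + 1) (2 * k) L₁ (by rwa [e1, e2, ← e3])
      fun I hI => key I (List.mem_append_left _ hI)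
    obtain ⟨t₂, ht₂⟩ := ih (n + 1) (2 * k + 1) L₂ (by rwa [e4])
      fun I hI => key I (List.mem_append_right _ hI)
    rw [e1, e2] at ht₁
    rw [e3, e4] at ht₂
    exact ⟨.node () t₁ t₂, by rw [leafIntervals, ht₁, ht₂]⟩

theorem exists_leafIntervals_zero_one_eq (L : List (ℝ × ℝ)) (hT : Tiles 0 L 1)
    (hL : ∀ I ∈ L, ∃ (n' : ℕ) (k' : ℤ), I = dyadicInterval n' k') :
    ∃ t, leafIntervals t 0 1 = L := by
  obtain ⟨e, he⟩ : ∃ e : ℕ, ∀ I ∈ L, ∃ (n' : ℕ) (k' : ℤ), n' ≤ e ∧ I = dyadicInterval n' k' := by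
    clear hT
    induction L with
    | nil => exact ⟨0, by simp⟩
    | cons I L ih =>
      obtain ⟨e, he⟩ := ih fun J hJ => hL J (by simp [hJ])
      obtain ⟨n, k, rfl⟩ := hL I (by simp)
      refine ⟨max n e, fun J hJ => ?_⟩
      rcases List.mem_cons.1 hJ with rfl | hJ
      · exact ⟨n, k, le_max_left _ _, rfl⟩
      · obtain ⟨n', k', h, rfl⟩ := he J hJ
        exact ⟨n', k', h.trans (le_max_right _ _), rfl⟩
  have e0 : (dyadicInterval 0 0).1 = 0 := by simp [dyadicInterval]
  have e1 : (dyadicInterval 0 0).2 = 1 := by simp [dyadicInterval]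
  have := exists_leafIntervals_eq e 0 0 L (by rwa [e0, e1]) (by simpa using he)
  rwa [e0, e1] at this

/-- An element of `T` maps each dyadic interval of a sufficiently small length linearly onto a
dyadic interval. -/
theorem exists_uniform_subdivision {f : UnitAddCircle ≃ₜ UnitAddCircle} (hf : f ∈ thompsonT) :
    ∃ N : ℕ, ∀ j : ℕ, j < 2 ^ N → ∃ n m : ℕ, m < 2 ^ n ∧
      ∀ s ∈ Set.Icc ((j : ℝ) / 2 ^ N) ((j + 1) / 2 ^ N),
        f (s : UnitAddCircle) =
          ((m / 2 ^ n + 2 ^ N / 2 ^ n * (s - j / 2 ^ N) : ℝ) : UnitAddCircle) := by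
  obtain ⟨D, hD, hf⟩ := hf
  have hD' : ∀ᶠ N : ℕ in Filter.atTop, ∀ d ∈ D, ∃ m : ℤ, d = m / 2 ^ N := by
    refine (Filter.eventually_all_finset D).2 fun d hd => ?_
    obtain ⟨m, n, rfl⟩ := exists_eq_int_div_two_pow (hD d hd)
    filter_upwards [Filter.eventually_ge_atTop n] with N hN
    obtain ⟨j, rfl⟩ := Nat.exists_eq_add_of_le hN
    exact ⟨m * 2 ^ j, by push_cast; rw [pow_add]; field_simp⟩
  obtain ⟨N₀, hN₀⟩ := hD'.exists
  have hlin : ∀ i ∈ Finset.range (2 ^ N₀),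
      IsDyadicLinearOn f ((i : ℝ) / 2 ^ N₀) ((i + 1) / 2 ^ N₀) := by
    intro i hi
    have hi' : (i : ℝ) + 1 ≤ 2 ^ N₀ := by exact_mod_cast Finset.mem_range.1 hi
    refine hf _ _ (by positivity) (by gcongr; linarith) ((div_le_one (by positivity)).2 hi') ?_
    intro d hd hdm
    obtain ⟨m, rfl⟩ := hN₀ d hd
    have hp : (0 : ℝ) < 2 ^ N₀ := by positivity
    have h1 : (i : ℝ) < m := (div_lt_div_iff_of_pos_right hp).1 hdm.1
    have h2 : (m : ℝ) < i + 1 := (div_lt_div_iff_of_pos_right hp).1 hdm.2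
    have h1' : (i : ℤ) < m := by exact_mod_cast h1
    have h2' : m < (i : ℤ) + 1 := by exact_mod_cast h2
    omega
  have hev : ∀ᶠ N : ℕ in Filter.atTop, ∀ i ∈ Finset.range (2 ^ N₀), ∃ (n : ℕ) (c : ℤ),
      ∀ s ∈ Set.Icc ((i : ℝ) / 2 ^ N₀) ((i + 1) / 2 ^ N₀),
        f (s : UnitAddCircle) = ((2 ^ N / 2 ^ n * s + c / 2 ^ n : ℝ) : UnitAddCircle) := by
    refine (Filter.eventually_all_finset _).2 fun i hi => ?_
    obtain ⟨k, b, hb, h⟩ := hlin i hi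
    obtain ⟨a, q, rfl⟩ := exists_eq_int_div_two_pow hb
    filter_upwards [Filter.eventually_ge_atTop (k.natAbs + q)] with N hN
    obtain ⟨r, hr⟩ : ∃ r : ℕ, (N : ℤ) = k + (q + r) := ⟨(N - k - q).toNat, by omega⟩
    refine ⟨q + r, a * 2 ^ r, fun s hs => ?_⟩
    have e : (2 : ℝ) ^ N = 2 ^ k * 2 ^ (q + r) := by
      rw [← zpow_natCast, hr, zpow_add₀ two_ne_zero, ← zpow_natCast]; push_cast; rfl
    rw [h s hs, e]
    congr 1
    push_cast
    rw [pow_add]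
    field_simp
  obtain ⟨N, hN, hle⟩ := (hev.and (Filter.eventually_ge_atTop N₀)).exists
  obtain ⟨r, rfl⟩ := Nat.exists_eq_add_of_le hle
  refine ⟨N₀ + r, fun j hj => ?_⟩
  have hr : 0 < 2 ^ r := by positivity
  obtain ⟨n, c, h⟩ := hN (j / 2 ^ r) (Finset.mem_range.2 (by
    rw [Nat.div_lt_iff_lt_mul hr, ← pow_add]; exact hj))
  have hmod : ((j + c) % 2 ^ n : ℤ) = ((j + c) % 2 ^ n : ℤ).toNat :=
    (Int.toNat_of_nonneg (Int.emod_nonneg _ (by positivity))).symm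
  refine ⟨n, ((j + c) % 2 ^ n : ℤ).toNat, ?_, fun s hs => ?_⟩
  · have := Int.emod_lt_of_pos (j + c) (show (0 : ℤ) < 2 ^ n by positivity)
    rw [hmod] at this
    exact_mod_cast this
  · have h1 : (j / 2 ^ r : ℕ) * 2 ^ r ≤ j := Nat.div_mul_le_self _ _
    have h2 : j + 1 ≤ ((j / 2 ^ r : ℕ) + 1) * 2 ^ r := Nat.lt_div_mul_add hr |>.trans_eq (by ring)
    have h1' : ((j / 2 ^ r : ℕ) : ℝ) * 2 ^ r ≤ j := by exact_mod_cast h1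
    have h2' : (j : ℝ) + 1 ≤ (((j / 2 ^ r : ℕ) : ℝ) + 1) * 2 ^ r := by exact_mod_cast h2
    rw [h s ⟨?_, ?_⟩]
    · refine coe_eq_coe_iff.2 ⟨(j + c) / 2 ^ n, ?_⟩
      have hdm : ((2 ^ n : ℤ) : ℝ) * (((j + c) / 2 ^ n : ℤ) : ℝ) +
          (((j + c) % 2 ^ n : ℤ).toNat : ℤ) = j + c := by
        rw [← hmod]
        exact_mod_cast Int.mul_ediv_add_emod (j + c) (2 ^ n)
      have e : (((((j : ℤ) + c) % 2 ^ n).toNat : ℕ) : ℝ) =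
          j + c - 2 ^ n * (((j + c) / 2 ^ n : ℤ) : ℝ) := by
        push_cast at hdm ⊢
        linarith
      rw [e]
      field_simp
      ring
    · refine le_trans ?_ hs.1
      rw [div_le_div_iff₀ (by positivity) (by positivity), pow_add]
      nlinarith [show (0 : ℝ) < 2 ^ N₀ by positivity]
    · refine hs.2.trans ?_
      rw [div_le_div_iff₀ (by positivity) (by positivity), pow_add]
      nlinarith [show (0 : ℝ) < 2 ^ N₀ by positivity]

theorem eq_of_coe_eq_coe {x y : ℝ} (h : (x : UnitAddCircle) = (y : UnitAddCircle))
    (h1 : x - y < 1) (h2 : y - x < 1) : x = y := by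
  obtain ⟨n, hn⟩ := coe_eq_coe_iff.1 h
  have h3 : (n : ℝ) < 1 := by linarith
  have h4 : (-1 : ℝ) < n := by linarith
  have h3' : n < 1 := by exact_mod_cast h3
  have h4' : -1 < n := by exact_mod_cast h4
  obtain rfl : n = 0 := by omega
  simpa using hn

/-- The images of the dyadic intervals of a small length, in their cyclic order and starting from
the one at `0`, are the intervals of the leaves of the output tree. -/
theorem exists_represents {f : UnitAddCircle ≃ₜ UnitAddCircle} (hf : f ∈ thompsonT) :
    ∃ P : TreePair, P.Represents f := by
  obtain ⟨N, hN⟩ := exists_uniform_subdivision hf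
  choose! n m hm h using hN
  obtain ⟨K, hK⟩ : ∃ K, K = 2 ^ N := ⟨_, rfl⟩
  have hKpos : 0 < K := by rw [hK]; positivity
  have hK' : (2 : ℝ) ^ N = K := by rw [hK]; push_cast; rfl
  have hKR : (0 : ℝ) < K := by exact_mod_cast hKpos
  rw [← hK, hK'] at h
  rw [← hK] at hm
  let J : ℕ → ℝ × ℝ := fun j => dyadicInterval (n j) (m j)
  have hJ0 : ∀ j, 0 ≤ (J j).1 := fun j => by
    show (0 : ℝ) ≤ ((m j : ℤ) : ℝ) / 2 ^ n j
    push_cast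
    positivity
  have hJ1 : ∀ j < K, (J j).2 ≤ 1 := fun j hj => by
    have : (m j : ℝ) + 1 ≤ 2 ^ n j := by exact_mod_cast hm j hj
    show (((m j : ℤ) : ℝ) + 1) / 2 ^ n j ≤ 1
    rw [div_le_one (by positivity)]
    exact_mod_cast this
  have hJlt : ∀ j, (J j).1 < (J j).2 := fun j => dyadicInterval_lt _ _
  have hlen : ∀ j, (J j).2 - (J j).1 = 1 / 2 ^ n j := fun j => dyadicInterval_length _ _
  have hfJ : ∀ j < K, ∀ s ∈ Set.Icc ((j : ℝ) / K) ((j + 1) / K),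
      f (s : UnitAddCircle) = (((J j).1 + K / 2 ^ n j * (s - j / K) : ℝ) : UnitAddCircle) := by
    intro j hj s hs
    rw [h j hj s hs]
    rfl
  have hle : ∀ j : ℕ, (j : ℝ) / K ≤ (j + 1) / K := fun j => by gcongr; linarith
  have hleft : ∀ j < K, f (((j : ℝ) / K : ℝ) : UnitAddCircle) = ((J j).1 : UnitAddCircle) := by
    intro j hj
    rw [hfJ j hj _ ⟨le_rfl, hle j⟩, sub_self, mul_zero, add_zero]
  have hright : ∀ j < K,
      f ((((j : ℝ) + 1) / K : ℝ) : UnitAddCircle) = ((J j).2 : UnitAddCircle) := by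
    intro j hj
    rw [hfJ j hj _ ⟨hle j, le_rfl⟩]
    congr 1
    have := hlen j
    have e : (K : ℝ) / 2 ^ n j * ((j + 1) / K - j / K) = 1 / 2 ^ n j := by field_simp; ring
    linarith
  have hlin : ∀ j < K, LinOn f ((j : ℝ) / K, (j + 1) / K) (J j) := by
    intro j hj s hs
    rw [hfJ j hj s ⟨hs.1, hs.2.le⟩, hlen j]
    congr 3
    dsimp only
    field_simp
    ring
  -- the interval which is mapped to an interval starting at `0`
  obtain ⟨i₀, hi₀, hi₀J⟩ : ∃ i₀ < K, (J i₀).1 = 0 := by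
    obtain ⟨s, h0, h1, hs⟩ := exists_rep (f.symm 0)
    have hs' : f (s : UnitAddCircle) = ((0 : ℝ) : UnitAddCircle) := by
      rw [hs, f.apply_symm_apply]; rfl
    have hfl := Nat.floor_le (show 0 ≤ s * K by positivity)
    have hfl' := Nat.lt_floor_add_one (s * K)
    have hj : ⌊s * K⌋₊ < K := by
      rw [Nat.floor_lt (by positivity)]
      nlinarith
    have hs1 : ((⌊s * K⌋₊ : ℕ) : ℝ) / K ≤ s := (div_le_iff₀ hKR).2 hfl
    have hs2 : s < ((⌊s * K⌋₊ : ℕ) + 1 : ℝ) / K := (lt_div_iff₀ hKR).2 hfl'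
    refine ⟨_, hj, ?_⟩
    have h3 := hJ1 _ hj
    have h4 := hJ0 ⌊s * K⌋₊
    have h5 := hlen ⌊s * K⌋₊
    generalize ⌊s * K⌋₊ = j at *
    have h6 : 0 ≤ (K : ℝ) / 2 ^ n j * (s - j / K) :=
      mul_nonneg (by positivity) (by linarith)
    have h7 : (K : ℝ) / 2 ^ n j * (s - j / K) < 1 / 2 ^ n j := by
      have : (1 : ℝ) / 2 ^ n j = K / 2 ^ n j * ((j + 1) / K - j / K) := by field_simp; ring
      rw [this]
      exact mul_lt_mul_of_pos_left (by linarith) (by positivity)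
    have := eq_of_coe_eq_coe ((hfJ j hj s ⟨hs1, hs2.le⟩).symm.trans hs') (by linarith)
      (by linarith)
    linarith
  have huniq : ∀ j < K, (J j).1 = 0 → j = i₀ := by
    intro j hj hj0
    have e : ((j : ℝ) / K : ℝ) = (i₀ : ℝ) / K := by
      have hjK : (j : ℝ) < K := by exact_mod_cast hj
      have hiK : (i₀ : ℝ) < K := by exact_mod_cast hi₀
      have b1 : (j : ℝ) / K < 1 := (div_lt_one hKR).2 hjK
      have b2 : (i₀ : ℝ) / K < 1 := (div_lt_one hKR).2 hiK
      have b3 : 0 ≤ (j : ℝ) / K := by positivity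
      have b4 : 0 ≤ (i₀ : ℝ) / K := by positivity
      refine eq_of_coe_eq_coe (f.injective ?_) (by linarith) (by linarith)
      rw [hleft j hj, hleft i₀ hi₀, hj0, hi₀J]
    rw [div_left_inj' hKR.ne'] at e
    exact_mod_cast e
  -- consecutive images fit together
  have hnext : ∀ j < K, (J j).2 = if (j + 1) % K = i₀ then 1 else (J ((j + 1) % K)).1 := by
    intro j hj
    have hr := Nat.mod_lt (j + 1) hKpos
    have e : ((J j).2 : UnitAddCircle) = ((J ((j + 1) % K)).1 : UnitAddCircle) := by
      rw [← hleft _ hr, ← hright j hj]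
      congr 1
      obtain ⟨q, hq⟩ : ∃ q : ℕ, (j + 1) % K + K * q = j + 1 := ⟨_, Nat.mod_add_div (j + 1) K⟩
      refine coe_eq_coe_iff.2 ⟨q, ?_⟩
      have : (((j + 1) % K : ℕ) : ℝ) + K * q = j + 1 := by exact_mod_cast hq
      rw [← this, Int.cast_natCast]
      field_simp
    have a1 := hJ1 j hj
    have a2 := hJlt j
    have a3 := hJ0 j
    have b1 := hJ1 _ hr
    have b2 := hJlt ((j + 1) % K)
    have b3 := hJ0 ((j + 1) % K)
    split_ifs with hc
    · rw [hc, hi₀J] at e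
      have : ((1 : ℝ) : UnitAddCircle) = ((0 : ℝ) : UnitAddCircle) :=
        coe_eq_coe_iff.2 ⟨1, by simp⟩
      exact eq_of_coe_eq_coe (e.trans this.symm) (by linarith) (by linarith)
    · have : (J ((j + 1) % K)).1 ≠ 0 := fun h0 => hc (huniq _ hr h0)
      have : 0 < (J ((j + 1) % K)).1 := lt_of_le_of_ne b3 this.symm
      exact eq_of_coe_eq_coe e (by linarith) (by linarith)
  obtain ⟨R, hR⟩ := exists_leafIntervals_zero_one_eq
    ((List.range K).map fun j : ℕ => ((j : ℝ) / K, ((j : ℝ) + 1) / K)) (by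
      have := tiles_map_range (fun j : ℕ => ((j : ℝ) / K, ((j : ℝ) + 1) / K))
        (fun j : ℕ => (j : ℝ) / K) K (fun p _ => ⟨rfl, by push_cast; rfl⟩)
      simpa [hKR.ne'] using this) (by
      intro I hI
      obtain ⟨j, -, rfl⟩ := List.mem_map.1 hI
      exact ⟨N, j, by simp [dyadicInterval, hK']⟩)
  obtain ⟨S, hS⟩ := exists_leafIntervals_zero_one_eq
    ((List.range K).map fun p => J ((i₀ + p) % K)) (by
      have := tiles_map_range (fun p => J ((i₀ + p) % K))
        (fun p : ℕ => if p < K then (J ((i₀ + p) % K)).1 else 1) K (fun p hp => ⟨by simp [hp], ?_⟩)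
      · simpa [hKpos, Nat.mod_eq_of_lt hi₀, hi₀J] using this
      · rw [hnext _ (Nat.mod_lt _ hKpos), Nat.mod_add_mod, add_assoc]
        by_cases hc : p + 1 < K
        · rw [if_pos hc, if_neg]
          intro h0
          rcases lt_or_ge (i₀ + (p + 1)) K with h1 | h1
          · rw [Nat.mod_eq_of_lt h1] at h0; omega
          · rw [Nat.mod_eq_sub_mod h1, Nat.mod_eq_of_lt (by omega)] at h0; omega
        · obtain rfl : K = p + 1 := by omega
          rw [if_neg hc, if_pos]
          rw [Nat.add_mod_right, Nat.mod_eq_of_lt hi₀]) (by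
      intro I hI
      obtain ⟨p, -, rfl⟩ := List.mem_map.1 hI
      exact ⟨_, _, rfl⟩)
  have hRl : R.numLeaves = K := by rw [← length_leafIntervals R 0 1, hR]; simp
  have hSl : S.numLeaves = K := by rw [← length_leafIntervals S 0 1, hS]; simp
  obtain ⟨k, hk⟩ : ∃ k, k = if i₀ = 0 then 0 else K - i₀ := ⟨_, rfl⟩
  have hkR : k < R.numLeaves := by split_ifs at hk <;> omega
  refine ⟨⟨R, S, hRl.trans hSl.symm, ⟨k, hkR⟩⟩, ?_⟩
  rw [TreePair.represents_iff]
  intro q I I' hq hI hI'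
  have hq : q < K := hRl ▸ hq
  have hI : (leafIntervals R 0 1)[q]? = some I := hI
  have hI' : (leafIntervals S 0 1)[if q + k < R.numLeaves then q + k
    else q + k - R.numLeaves]? = some I' := hI'
  obtain ⟨r, hr⟩ : ∃ r, r = if q + k < R.numLeaves then q + k else q + k - R.numLeaves := ⟨_, rfl⟩
  rw [← hr, hS, List.getElem?_map] at hI'
  rw [hR, List.getElem?_map, List.getElem?_range hq] at hI
  have hrK : r < K := by split_ifs at hr hk <;> omega
  rw [List.getElem?_range hrK] at hI'
  have e : (i₀ + r) % K = q := by
    rcases lt_or_ge (i₀ + r) K with h1 | h1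
    · rw [Nat.mod_eq_of_lt h1]; split_ifs at hr hk <;> omega
    · rw [Nat.mod_eq_sub_mod h1, Nat.mod_eq_of_lt (by omega)]; split_ifs at hr hk <;> omega
  simp only [Option.map_some, Option.some_inj, e] at hI hI'
  rw [← hI, ← hI']
  exact hlin q hq

/-- The elements of `T` with bipartite Thompson graph are those which change the parities of the
binary digits of all dyadic points by the same amount. -/
theorem jonesT_eq : jonesT = (parityGroup : Set (UnitAddCircle ≃ₜ UnitAddCircle)) := by
  ext f
  constructor
  · rintro ⟨hf, P, hP, -, hb⟩
    exact (hP.isBipartite_iff hf).1 hb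
  · intro hf
    obtain ⟨P, hP⟩ := exists_represents hf.1
    obtain ⟨Q, hQ, hred⟩ := hP.exists_reduced
    exact ⟨hf.1, Q, hQ, hred, (hQ.isBipartite_iff hf.1).2 hf⟩

/-! ### The generated subgroup -/

/-- The subgroup which is generated by `x₀ x₁`, `x₁ x₂`, `x₂ x₃` and the rotation. -/
def generatedSubgroup : Subgroup (UnitAddCircle ≃ₜ UnitAddCircle) :=
  Subgroup.closure {yGen 0, yGen 1, yGen 2, rotHalf}

theorem rotHalf_mem_generatedSubgroup : rotHalf ∈ generatedSubgroup :=
  Subgroup.subset_closure (by simp)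

theorem yGen_mem_generatedSubgroup (n : ℕ) : yGen n ∈ generatedSubgroup := by
  induction n using Nat.strong_induction_on with
  | _ n ih =>
    match n, ih with
    | 0, _ => exact Subgroup.subset_closure (by simp)
    | 1, _ => exact Subgroup.subset_closure (by simp)
    | 2, _ => exact Subgroup.subset_closure (by simp)
    | n + 3, ih =>
      have h : yGen 0 * yGen (n + 1) = yGen (n + 3) * yGen 0 := yGen_relation n
      rw [eq_mul_inv_iff_mul_eq.2 h.symm]
      exact mul_mem (mul_mem (ih 0 (by omega)) (ih (n + 1) (by omega))) (inv_mem (ih 0 (by omega)))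

theorem generatedSubgroup_le_parityGroup : generatedSubgroup ≤ parityGroup := by
  refine (Subgroup.closure_le _).2 ?_
  rintro f (rfl | rfl | rfl | rfl)
  · exact yGen_mem_parityGroup 0
  · exact yGen_mem_parityGroup 1
  · exact yGen_mem_parityGroup 2
  · exact rotHalf_mem_parityGroup

/-- Some element of the generated subgroup maps the leaves of `t` to the leaves of `u`, in their
order from left to right. -/
def TreeEquiv (t u : BinaryTree Unit) : Prop :=
  ∃ h ∈ generatedSubgroup, MapsIntervals h (leafIntervals t 0 1) (leafIntervals u 0 1)

theorem TreeEquiv.refl (t : BinaryTree Unit) : TreeEquiv t t := by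
  refine ⟨1, one_mem _, LinOn.mapsIntervals_leafIntervals t one_pos fun s _ => ?_⟩
  simp

theorem TreeEquiv.trans {t u v : BinaryTree Unit} (h : TreeEquiv t u) (h' : TreeEquiv u v) :
    TreeEquiv t v := by
  obtain ⟨f, hf, hf'⟩ := h
  obtain ⟨g, hg, hg'⟩ := h'
  exact ⟨g * f, mul_mem hg hf,
    hf'.trans hg' (leafIntervals_pos _ one_pos) (leafIntervals_pos _ one_pos)⟩

/-! ### Right combs -/

/-- The tree made of a path of right edges which starts at the root, with the trees of the list
hanging down from the vertices of this path; the last tree of the list hangs at its end. -/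
def comb : List (BinaryTree Unit) → BinaryTree Unit
  | [] => .nil
  | [t] => t
  | t :: u :: L => .node () t (comb (u :: L))

theorem comb_cons (t : BinaryTree Unit) {L : List (BinaryTree Unit)} (hL : L ≠ []) :
    comb (t :: L) = .node () t (comb L) := by
  cases L with
  | nil => exact absurd rfl hL
  | cons u L => rfl

/-- On a comb with the root interval `[1 - 2⁻ⁿ, 1)`, the element `yₙ₊ₖ` spreads out the three parts
of the tree which hangs at the vertex number `k`, where `k` is the length of `A`. If `B` is empty,
the two combs are equal, and `yₙ₊ₖ` does not fix their leaves. -/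
theorem mapsIntervals_yGen_comb (n : ℕ) (A B : List (BinaryTree Unit))
    (o₁ o₂ o₃ : BinaryTree Unit) (hB : B ≠ []) :
    MapsIntervals (yGen (n + A.length))
      (leafIntervals (comb (A ++ .node () o₁ (.node () o₂ o₃) :: B)) (1 - (1 / 2) ^ n) 1)
      (leafIntervals (comb (A ++ o₁ :: o₂ :: o₃ :: B)) (1 - (1 / 2) ^ n) 1) := by
  induction A generalizing n with
  | nil =>
    obtain ⟨h1, h2, h3, h4⟩ := linOn_yGen_cones n
    have hd := half_pow_pos n
    simp only [List.nil_append, List.length_nil, add_zero]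
    rw [comb_cons _ hB, comb_cons o₁ (by simp), comb_cons o₂ (by simp), comb_cons o₃ hB]
    simp only [leafIntervals, List.append_assoc]
    set d : ℝ := (1 / 2) ^ n
    refine MapsIntervals.append ?_ (MapsIntervals.append ?_ (MapsIntervals.append ?_ ?_)) <;>
      refine LinOn.mapsIntervals_leafIntervals _ (by linarith) ?_
    · convert h1 using 2 <;> ring
    · convert h2 using 2 <;> ring
    · convert h3 using 2 <;> ring
    · convert h4 using 2 <;> ring
  | cons a A ih =>
    have hn : (1 - (1 / 2 : ℝ) ^ n + 1) / 2 = 1 - (1 / 2) ^ (n + 1) := by rw [pow_succ]; ring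
    have hp := half_pow_pos n
    have hp' := half_pow_le_one n
    rw [List.cons_append, List.cons_append, comb_cons a (by simp), comb_cons a (by simp),
      List.length_cons, show n + (A.length + 1) = n + 1 + A.length by ring]
    simp only [leafIntervals]
    refine MapsIntervals.append (LinOn.mapsIntervals_leafIntervals _ (by linarith) ?_) ?_
    · refine linOn_yGen_left _ (by dsimp only; linarith) (by dsimp only; linarith) ?_
      dsimp only
      rw [hn]
      have := pow_le_pow_of_le_one (show (0 : ℝ) ≤ 1 / 2 by norm_num) (by norm_num)
        (show n + 1 ≤ n + 1 + A.length by omega)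
      linarith
    · rw [hn]
      exact ih (n + 1)

/-- A full ternary tree, drawn as a binary tree by replacing each vertex with three children by two
carets, the second one at the right leaf of the first one. -/
inductive IsTernary : BinaryTree Unit → Prop
  | nil : IsTernary .nil
  | node {o₁ o₂ o₃ : BinaryTree Unit} : IsTernary o₁ → IsTernary o₂ → IsTernary o₃ →
      IsTernary (.node () o₁ (.node () o₂ o₃))

theorem comb_append_ternary (A : List (BinaryTree Unit)) (o₁ o₂ o₃ : BinaryTree Unit) :
    comb (A ++ [.node () o₁ (.node () o₂ o₃)]) = comb (A ++ [o₁, o₂, o₃]) := by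
  induction A with
  | nil => rfl
  | cons a A ih =>
    rw [List.cons_append, List.cons_append, comb_cons a (by simp), comb_cons a (by simp), ih]

/-- A ternary tree which hangs on a comb can be spread out on the comb. -/
theorem IsTernary.treeEquiv_comb {o : BinaryTree Unit} (ho : IsTernary o)
    (A B : List (BinaryTree Unit)) :
    TreeEquiv (comb (A ++ o :: B)) (comb (A ++ List.replicate o.numLeaves .nil ++ B)) := by
  induction ho generalizing A B with
  | nil => simpa using TreeEquiv.refl _
  | @node o₁ o₂ o₃ _ _ _ ih₁ ih₂ ih₃ =>
    have h : TreeEquiv (comb (A ++ .node () o₁ (.node () o₂ o₃) :: B))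
        (comb (A ++ o₁ :: o₂ :: o₃ :: B)) := by
      rcases eq_or_ne B [] with rfl | hB
      · rw [comb_append_ternary]
        exact .refl _
      · refine ⟨yGen A.length, yGen_mem_generatedSubgroup _, ?_⟩
        simpa using mapsIntervals_yGen_comb 0 A B o₁ o₂ o₃ hB
    refine h.trans ((ih₁ A _).trans ((ih₂ _ _).trans ?_))
    refine (ih₃ (A ++ List.replicate o₁.numLeaves .nil ++ List.replicate o₂.numLeaves .nil)
      B).trans ?_
    simp only [BinaryTree.numLeaves, List.replicate_add, List.append_assoc]
    exact .refl _

/-! ### Trees with alternating leaf colors -/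

/-- The alternating list of colors of length `n` which begins with `c`. -/
def altColors : ZMod 2 → ℕ → List (ZMod 2)
  | _, 0 => []
  | c, n + 1 => c :: altColors (c + 1) n

@[simp]
theorem length_altColors (c : ZMod 2) (n : ℕ) : (altColors c n).length = n := by
  induction n generalizing c with
  | zero => rfl
  | succ n ih => simp [altColors, ih]

theorem altColors_add (c : ZMod 2) (m n : ℕ) :
    altColors c (m + n) = altColors c m ++ altColors (c + m) n := by
  induction m generalizing c with
  | zero => simp [altColors]
  | succ m ih =>
    rw [show m + 1 + n = m + n + 1 by ring, altColors, altColors, ih, List.cons_append]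
    congr 3
    push_cast
    ring

theorem leafColors_eq_cons (t : BinaryTree Unit) (c : ZMod 2) : ∃ L, leafColors t c = c :: L := by
  induction t generalizing c with
  | nil => exact ⟨[], rfl⟩
  | node _ l r hl _ =>
    obtain ⟨L, h⟩ := hl c
    exact ⟨L ++ leafColors r (c + 1), by rw [leafColors, h, List.cons_append]⟩

/-- In a tree with alternating leaf colors, the left subtree of the root has an odd number of
leaves, as the first leaf of the right subtree has a color other than the root. -/
theorem leafColors_node_alternating {l r : BinaryTree Unit} {c : ZMod 2}
    (h : leafColors (.node () l r) c = altColors c (l.numLeaves + r.numLeaves)) :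
    Odd l.numLeaves ∧ leafColors l c = altColors c l.numLeaves ∧
      leafColors r (c + 1) = altColors (c + 1) r.numLeaves := by
  rw [leafColors, altColors_add] at h
  obtain ⟨h1, h2⟩ := List.append_inj h (by simp)
  have h3 : c + (l.numLeaves : ZMod 2) = c + 1 := by
    obtain ⟨L, hL⟩ := leafColors_eq_cons r (c + 1)
    obtain ⟨n, hn⟩ := Nat.exists_eq_add_of_le' r.numLeaves_pos
    rw [hL, hn, altColors] at h2
    exact (List.cons_eq_cons.1 h2).1.symm
  rw [h3] at h2
  refine ⟨?_, h1, h2⟩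
  rw [← ZMod.natCast_eq_one_iff_odd]
  exact add_left_cancel h3

theorem isTernary_of_alternating (t : BinaryTree Unit) (c : ZMod 2)
    (h : leafColors t c = altColors c t.numLeaves) :
    (Odd t.numLeaves → IsTernary t) ∧
    (Even t.numLeaves → ∃ o₁ o₂, IsTernary o₁ ∧ IsTernary o₂ ∧ t = .node () o₁ o₂) := by
  induction t generalizing c with
  | nil => exact ⟨fun _ => .nil, fun h => absurd h (by simp)⟩
  | node _ l r hl hr =>
    obtain ⟨h1, h2, h3⟩ := leafColors_node_alternating h
    have hl' := (hl c h2).1 h1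
    obtain ⟨hr1, hr2⟩ := hr (c + 1) h3
    constructor
    · intro hodd
      obtain ⟨o₁, o₂, ho₁, ho₂, rfl⟩ := hr2 ((Nat.odd_add.1 hodd).1 h1)
      exact .node hl' ho₁ ho₂
    · intro heven
      refine ⟨l, r, hl', hr1 ?_, rfl⟩
      by_contra hc
      rw [BinaryTree.numLeaves, Nat.even_add] at heven
      exact (Nat.not_even_iff_odd.2 h1) (heven.2 (Nat.not_odd_iff_even.1 hc))

/-- The leaves of a tree with alternating colors can be mapped to the leaves of the comb. -/
theorem treeEquiv_comb_of_alternating {t : BinaryTree Unit} {c : ZMod 2}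
    (h : leafColors t c = altColors c t.numLeaves) :
    TreeEquiv t (comb (List.replicate t.numLeaves .nil)) := by
  obtain ⟨h1, h2⟩ := isTernary_of_alternating t c h
  rcases Nat.even_or_odd t.numLeaves with he | ho
  · obtain ⟨o₁, o₂, ho₁, ho₂, rfl⟩ := h2 he
    have e := (ho₁.treeEquiv_comb [] [o₂]).trans (ho₂.treeEquiv_comb _ [])
    rw [List.append_nil, List.nil_append, List.nil_append, ← List.replicate_add] at e
    exact e
  · have e := (h1 ho).treeEquiv_comb [] []
    rw [List.append_nil, List.nil_append] at e
    exact e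

/-! ### Refinement to alternating colors -/

/-- Bisect those intervals of a list which are marked in the list of Booleans. -/
noncomputable def bisect : List Bool → List (ℝ × ℝ) → List (ℝ × ℝ)
  | true :: bs, I :: L => (I.1, (I.1 + I.2) / 2) :: ((I.1 + I.2) / 2, I.2) :: bisect bs L
  | false :: bs, I :: L => I :: bisect bs L
  | _, _ => []

/-- The effect of `bisect` on the colors of the intervals. -/
def bisectColors : List Bool → List (ZMod 2) → List (ZMod 2)
  | true :: bs, c :: L => c :: (c + 1) :: bisectColors bs L
  | false :: bs, c :: L => c :: bisectColors bs L
  | _, _ => []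

theorem bisect_append {bs bs' : List Bool} {L L' : List (ℝ × ℝ)} (h : bs.length = L.length) :
    bisect (bs ++ bs') (L ++ L') = bisect bs L ++ bisect bs' L' := by
  induction bs generalizing L with
  | nil =>
    obtain rfl := List.length_eq_zero_iff.1 h.symm
    simp [bisect]
  | cons b bs ih =>
    cases L with
    | nil => simp at h
    | cons I L =>
      have := ih (L := L) (by simpa using h)
      cases b <;> simp [bisect, this]

theorem bisectColors_append {bs bs' : List Bool} {L L' : List (ZMod 2)}
    (h : bs.length = L.length) :
    bisectColors (bs ++ bs') (L ++ L') = bisectColors bs L ++ bisectColors bs' L' := by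
  induction bs generalizing L with
  | nil =>
    obtain rfl := List.length_eq_zero_iff.1 h.symm
    simp [bisectColors]
  | cons b bs ih =>
    cases L with
    | nil => simp at h
    | cons I L =>
      have := ih (L := L) (by simpa using h)
      cases b <;> simp [bisectColors, this]

/-- Carets can be attached to any set of leaves of a tree. -/
theorem exists_bisected_tree (t : BinaryTree Unit) (bs : List Bool)
    (h : bs.length = t.numLeaves) :
    ∃ t', (∀ a b, leafIntervals t' a b = bisect bs (leafIntervals t a b)) ∧
      ∀ c, leafColors t' c = bisectColors bs (leafColors t c) := by
  induction t generalizing bs with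
  | nil =>
    obtain ⟨b, rfl⟩ := List.length_eq_one_iff.1 h
    cases b
    · exact ⟨.nil, fun a b => rfl, fun c => rfl⟩
    · exact ⟨.node () .nil .nil, fun a b => rfl, fun c => rfl⟩
  | node _ l r hl hr =>
    have hlen : bs.length = l.numLeaves + r.numLeaves := h
    have h1 : (bs.take l.numLeaves).length = l.numLeaves := by simp [hlen]
    obtain ⟨l', hl1, hl2⟩ := hl (bs.take l.numLeaves) h1
    obtain ⟨r', hr1, hr2⟩ := hr (bs.drop l.numLeaves) (by simp [hlen])
    refine ⟨.node () l' r', fun a b => ?_, fun c => ?_⟩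
    · rw [leafIntervals, leafIntervals, hl1, hr1,
        ← bisect_append (by rw [h1, length_leafIntervals]), List.take_append_drop]
    · rw [leafColors, leafColors, hl2, hr2,
        ← bisectColors_append (by rw [h1, length_leafColors]), List.take_append_drop]

theorem MapsIntervals.bisect {f : UnitAddCircle → UnitAddCircle} {L M : List (ℝ × ℝ)}
    (h : MapsIntervals f L M) (hL : ∀ I ∈ L, I.1 < I.2) (bs : List Bool) :
    MapsIntervals f (JonesThompson.bisect bs L) (JonesThompson.bisect bs M) := by
  induction h generalizing bs with
  | nil => rcases bs with - | ⟨- | -, bs⟩ <;> exact .nil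
  | cons h1 _ ih =>
    have := ih fun I hI => hL I (by simp [hI])
    have hI := hL _ List.mem_cons_self
    rcases bs with - | ⟨- | -, bs⟩
    · exact .nil
    · exact .cons h1 (this bs)
    · exact .cons (h1.leftHalf hI) (.cons h1.rightHalf (this bs))

/-- Bisecting each interval which has the same color as the next one makes the colors
alternate. -/
theorem exists_bisectColors_eq_altColors (c : ZMod 2) (L : List (ZMod 2)) :
    ∃ (bs : List Bool) (n : ℕ), bs.length = (c :: L).length ∧
      bisectColors bs (c :: L) = altColors c n := by
  have two : ∀ c : ZMod 2, c + 1 + 1 = c := by decide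
  have cases2 : ∀ c d : ZMod 2, d = c ∨ d = c + 1 := by decide
  induction L generalizing c with
  | nil => exact ⟨[false], 1, rfl, rfl⟩
  | cons d L ih =>
    obtain ⟨bs, n, h1, h2⟩ := ih d
    rcases cases2 c d with rfl | rfl
    · exact ⟨true :: bs, n + 2, by simp [h1], by simp [bisectColors, altColors, h2, two]⟩
    · exact ⟨false :: bs, n + 1, by simp [h1], by simp [bisectColors, altColors, h2]⟩

/-- A map between the leaves of two trees with the same leaf colors belongs to the generated
subgroup. -/
theorem mem_generatedSubgroup_of_leafColors_eq {f : UnitAddCircle ≃ₜ UnitAddCircle}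
    {R S : BinaryTree Unit} (hf : MapsIntervals f (leafIntervals R 0 1) (leafIntervals S 0 1))
    (hc : leafColors R 0 = leafColors S 0) : f ∈ generatedSubgroup := by
  obtain ⟨L, hL⟩ := leafColors_eq_cons R 0
  obtain ⟨bs, n, h1, h2⟩ := exists_bisectColors_eq_altColors 0 L
  rw [← hL] at h1 h2
  obtain ⟨R', hR1, hR2⟩ := exists_bisected_tree R bs (by rw [h1, length_leafColors])
  obtain ⟨S', hS1, hS2⟩ := exists_bisected_tree S bs (by rw [h1, hc, length_leafColors])
  have hR' : leafColors R' 0 = altColors 0 n := (hR2 0).trans h2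
  have hS' : leafColors S' 0 = altColors 0 n := (hS2 0).trans (hc ▸ h2)
  have hRn : R'.numLeaves = n := by
    rw [← length_leafColors R' 0, hR', length_altColors]
  have hSn : S'.numLeaves = n := by
    rw [← length_leafColors S' 0, hS', length_altColors]
  obtain ⟨g, hg, hg'⟩ := treeEquiv_comb_of_alternating (t := R') (c := 0) (by rw [hRn, hR'])
  obtain ⟨h, hh, hh'⟩ := treeEquiv_comb_of_alternating (t := S') (c := 0) (by rw [hSn, hS'])
  rw [hRn] at hg'
  rw [hSn] at hh'
  have hf' : MapsIntervals f (leafIntervals R' 0 1) (leafIntervals S' 0 1) := by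
    rw [hR1, hS1]
    exact hf.bisect (leafIntervals_pos _ one_pos) bs
  have e : f = h⁻¹ * g := hf'.unique (hg'.trans
    (hh'.symm (leafIntervals_pos _ one_pos) (leafIntervals_pos _ one_pos))
    (leafIntervals_pos _ one_pos) (leafIntervals_pos _ one_pos))
  rw [e]
  exact mul_mem (inv_mem hh) hg

/-! ### Reduction to maps which fix `0` -/

theorem leafInterval_left_eq_zero {t : BinaryTree Unit} {j : ℕ} {J : ℝ × ℝ}
    (hJ : (leafIntervals t 0 1)[j]? = some J) (h0 : J.1 = 0) : j = 0 := by
  by_contra hj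
  obtain ⟨hj', rfl⟩ := List.getElem?_eq_some_iff.1 hJ
  have h1 := List.pairwise_iff_getElem.1 (pairwise_leafIntervals t one_pos) 0 j (by omega) hj'
    (by omega)
  have h2 := leafIntervals_bounds t one_pos _ (List.getElem_mem (show 0 < _ by omega))
  linarith [h2.1, h2.2.1]

/-- A map which fixes `0` identifies the leaves of its two trees without a shift, and as the color
of the first leaf is `0` in both trees, the colors of the leaves agree. -/
theorem mem_generatedSubgroup_of_map_zero {f : UnitAddCircle ≃ₜ UnitAddCircle}
    (hf : f ∈ parityGroup) (h0 : f 0 = 0) : f ∈ generatedSubgroup := by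
  obtain ⟨P, hP⟩ := exists_represents hf.1
  obtain ⟨e, he⟩ := P.isBipartite_iff.1 ((hP.isBipartite_iff hf.1).2 hf)
  have hpos := P.input.numLeaves_pos
  have hshift : P.shift.val = 0 := by
    have hg := P.glue_val ⟨0, hpos⟩
    simp only [zero_add, P.shift.2, if_true] at hg
    have h := hP ⟨0, hpos⟩
    obtain ⟨x, L, hx⟩ := leafIntervals_eq_cons P.input 0 1
    have hI : (leafInterval P.input ⟨0, hpos⟩).1 = 0 := by
      have := leafInterval_eq_getElem? P.input ⟨0, hpos⟩
      rw [hx] at this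
      simp only [List.getElem?_cons_zero, Option.some_inj] at this
      rw [← this]
    have hI2 := isCone_leafInterval P.input ⟨0, hpos⟩
    have hJ := leafIntervals_bounds _ one_pos _
      (leafInterval_mem P.output (P.glue ⟨0, hpos⟩))
    have h1 := LinOn.map_left h hI2.lt
    rw [hI, AddCircle.coe_zero, h0] at h1
    have h2 : 0 = (leafInterval P.output (P.glue ⟨0, hpos⟩)).1 :=
      eq_of_coe_eq_coe (by rw [AddCircle.coe_zero]; exact h1)
      (by linarith [hJ.1]) (by linarith [hJ.2.1, hJ.2.2])
    rw [← hg]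
    exact leafInterval_left_eq_zero (leafInterval_eq_getElem? _ _) h2.symm
  have hglue : ∀ i, (P.glue i : ℕ) = i := fun i => by
    rw [P.glue_val, hshift, add_zero, if_pos i.2]
  have hmaps : MapsIntervals f (leafIntervals P.input 0 1) (leafIntervals P.output 0 1) := by
    refine List.forall₂_iff_get.2 ⟨by simp [length_leafIntervals, P.numLeaves_eq],
      fun i hi hi' => ?_⟩
    rw [length_leafIntervals] at hi
    refine (P.represents_iff f).1 hP i _ _ hi (List.getElem?_eq_getElem _) ?_
    rw [hshift, add_zero, if_pos hi]
    exact List.getElem?_eq_getElem _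
  refine mem_generatedSubgroup_of_leafColors_eq hmaps ?_
  have he0 : e = 0 := by
    have := he ⟨0, hpos⟩
    rw [hglue, leafColor_zero, leafColor_zero, zero_add] at this
    exact this.symm
  refine List.ext_getElem (by simp [P.numLeaves_eq]) fun i hi hi' => ?_
  have hi2 : i < P.input.numLeaves := by simpa using hi
  have := he ⟨i, hi2⟩
  rw [hglue, he0, add_zero, leafColor, leafColor, List.getD_eq_getElem _ _ hi,
    List.getD_eq_getElem _ _ hi'] at this
  exact this.symm

theorem exists_map_to_zero_of_map {g : UnitAddCircle ≃ₜ UnitAddCircle}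
    (hg : g ∈ generatedSubgroup) {x y : UnitAddCircle} (hxy : g x = y)
    (hy : ∃ h ∈ generatedSubgroup, h y = 0) : ∃ h ∈ generatedSubgroup, h x = 0 := by
  obtain ⟨h, hh, h0⟩ := hy
  exact ⟨h * g, mul_mem hh hg, by show h (g x) = 0; rw [hxy, h0]⟩

/-- The generated subgroup acts transitively on the dyadic points of the circle. In `[0, 1/2)`
the element `x₀ x₁` is `s ↦ 2 s` for `s < 3/8` and `s ↦ s + 3/8` otherwise; in the second case a
rotation leads to `s - 1/8`, which is then doubled. So the denominator can always be lowered. -/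
theorem exists_map_to_zero (n : ℕ) (k : ℤ) :
    ∃ h ∈ generatedSubgroup, h (((k : ℝ) / 2 ^ n : ℝ) : UnitAddCircle) = 0 := by
  induction n generalizing k with
  | zero =>
    refine ⟨1, one_mem _, ?_⟩
    rw [← AddCircle.coe_zero]
    exact coe_eq_coe_iff.2 ⟨k, by simp⟩
  | succ n ih =>
    have hy := yGen_mem_generatedSubgroup 0
    have key : ∀ k : ℤ, 0 ≤ (k : ℝ) / 2 ^ (n + 1) → (k : ℝ) / 2 ^ (n + 1) < 1 / 2 →
        ∃ h ∈ generatedSubgroup, h (((k : ℝ) / 2 ^ (n + 1) : ℝ) : UnitAddCircle) = 0 := by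
      intro k h0 h1
      have e2 : 2 * ((k : ℝ) / 2 ^ (n + 1)) = k / 2 ^ n := by rw [pow_succ]; field_simp
      rcases lt_or_ge ((k : ℝ) / 2 ^ (n + 1)) (3 / 8) with h2 | h2
      · refine exists_map_to_zero_of_map hy ?_ (ih k)
        rw [yGen_coe 0 h0 (by linarith), pow_zero, ← e2]
        congr 1
        unfold yFun
        split_ifs <;> linarith
      · obtain ⟨j, rfl⟩ : ∃ j, n = j + 2 := by
          by_contra hc
          have hn : n = 0 ∨ n = 1 := by
            by_contra hn
            exact hc ⟨n - 2, by omega⟩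
          rw [le_div_iff₀ (by positivity)] at h2
          rw [div_lt_iff₀ (by positivity)] at h1
          rcases hn with rfl | rfl
          · norm_num at h1 h2
            have a1 : k < 1 := by exact_mod_cast h1
            have a2 : (0 : ℝ) < k := by linarith
            have a2' : 0 < k := by exact_mod_cast a2
            omega
          · norm_num at h1 h2
            have a1 : k < 2 := by exact_mod_cast h1
            have a2 : (1 : ℝ) < k := by linarith
            have a2' : 1 < k := by exact_mod_cast a2
            omega
        set s := (k : ℝ) / 2 ^ (j + 2 + 1) with hs
        have e3 : 2 * (s - 1 / 8) = ((k - 2 ^ j : ℤ) : ℝ) / 2 ^ (j + 2) := by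
          rw [hs]; push_cast; rw [pow_succ, pow_succ, pow_succ]; field_simp; ring
        have hy1 : yGen 0 (s : UnitAddCircle) = ((s + 3 / 8 : ℝ) : UnitAddCircle) := by
          rw [yGen_coe 0 h0 (by linarith), pow_zero]
          congr 1
          unfold yFun
          split_ifs <;> linarith
        have hr : rotHalf ((s + 3 / 8 : ℝ) : UnitAddCircle) =
            ((s - 1 / 8 : ℝ) : UnitAddCircle) := by
          rw [rotHalf_coe]
          exact coe_eq_coe_iff.2 ⟨1, by push_cast; ring⟩
        have hy2 : yGen 0 ((s - 1 / 8 : ℝ) : UnitAddCircle) =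
            ((((k - 2 ^ j : ℤ) : ℝ) / 2 ^ (j + 2) : ℝ) : UnitAddCircle) := by
          rw [yGen_coe 0 (by linarith) (by linarith), pow_zero, ← e3]
          congr 1
          unfold yFun
          split_ifs <;> linarith
        exact exists_map_to_zero_of_map hy hy1 (exists_map_to_zero_of_map
          rotHalf_mem_generatedSubgroup hr (exists_map_to_zero_of_map hy hy2 (ih _)))
    have hp : (0 : ℝ) < 2 ^ (n + 1) := by positivity
    set m := ⌊(k : ℝ) / 2 ^ (n + 1)⌋ with hm
    have hfl := Int.floor_le ((k : ℝ) / 2 ^ (n + 1))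
    have hfl' := Int.lt_floor_add_one ((k : ℝ) / 2 ^ (n + 1))
    rw [← hm] at hfl hfl'
    have e0 : ((k - m * 2 ^ (n + 1) : ℤ) : ℝ) / 2 ^ (n + 1) = k / 2 ^ (n + 1) - m := by
      push_cast; field_simp
    have e1 : ((k - m * 2 ^ (n + 1) - 2 ^ n : ℤ) : ℝ) / 2 ^ (n + 1) =
        k / 2 ^ (n + 1) - m - 1 / 2 := by
      push_cast; rw [pow_succ]; field_simp
    rcases lt_or_ge ((k : ℝ) / 2 ^ (n + 1) - m) (1 / 2) with h | h
    · refine exists_map_to_zero_of_map (one_mem _) ?_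
        (key (k - m * 2 ^ (n + 1)) (by rw [e0]; linarith) (by rw [e0]; linarith))
      rw [e0]
      exact coe_eq_coe_iff.2 ⟨m, by ring⟩
    · refine exists_map_to_zero_of_map rotHalf_mem_generatedSubgroup ?_
        (key (k - m * 2 ^ (n + 1) - 2 ^ n) (by rw [e1]; linarith) (by rw [e1]; linarith))
      rw [e1, rotHalf_coe]
      exact coe_eq_coe_iff.2 ⟨m + 1, by push_cast; ring⟩

/-- By transitivity on dyadic points it is enough to consider maps which fix `0`. -/
theorem parityGroup_eq_generatedSubgroup : parityGroup = generatedSubgroup := by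
  refine le_antisymm (fun f hf => ?_) generatedSubgroup_le_parityGroup
  obtain ⟨s, -, -, hs⟩ := exists_rep (f 0)
  have hsd : IsDyadic s :=
    isDyadic_of_map hf.1 (s := 0) (by simpa using isDyadic_int 0) hs.symm
  obtain ⟨k, n, rfl⟩ := exists_eq_int_div_two_pow hsd
  obtain ⟨h, hh, h0⟩ := exists_map_to_zero n k
  have h1 : h * f ∈ generatedSubgroup :=
    mem_generatedSubgroup_of_map_zero (mul_mem (generatedSubgroup_le_parityGroup hh) hf) (by
      show h (f 0) = 0
      rw [← hs, h0])
  exact (Subgroup.mul_mem_cancel_left _ hh).1 h1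

theorem generatedSubgroup_le_closure_jonesF :
    generatedSubgroup ≤ Subgroup.closure (jonesF ∪ {rotHalf}) := by
  have hy : ∀ n, yGen n ∈ jonesF := fun n => by
    refine ⟨jonesT_eq ▸ yGen_mem_parityGroup n, ?_⟩
    have hd := half_pow_pos n
    have hd' := half_pow_le_one n
    have := yGen_coe n le_rfl one_pos
    rw [AddCircle.coe_zero] at this
    rw [this, ← AddCircle.coe_zero]
    congr 1
    unfold yFun
    split_ifs <;> linarith
  refine (Subgroup.closure_le _).2 ?_
  rintro f (rfl | rfl | rfl | rfl)
  · exact Subgroup.subset_closure (Or.inl (hy 0))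
  · exact Subgroup.subset_closure (Or.inl (hy 1))
  · exact Subgroup.subset_closure (Or.inl (hy 2))
  · exact Subgroup.subset_closure (Or.inr rfl)

end JonesThompson

open JonesThompson in
theorem mainTheorem1 :
    jonesT = (Subgroup.closure (jonesF ∪ {rotHalf}) :
      Subgroup (UnitAddCircle ≃ₜ UnitAddCircle)) ∧
    jonesT = (Subgroup.closure
      {prodLR (xGen 0) (xGen 1), prodLR (xGen 1) (xGen 2), prodLR (xGen 2) (xGen 3), rotHalf} :
      Subgroup (UnitAddCircle ≃ₜ UnitAddCircle)) := by
  have h : jonesT = (generatedSubgroup : Set (UnitAddCircle ≃ₜ UnitAddCircle)) := by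
    rw [jonesT_eq, parityGroup_eq_generatedSubgroup]
  refine ⟨Set.Subset.antisymm ?_ ?_, h⟩
  · rw [h]
    exact generatedSubgroup_le_closure_jonesF
  · rw [jonesT_eq]
    refine (Subgroup.closure_le _).2 ?_
    rintro f (hf | rfl)
    · exact (jonesT_eq ▸ hf.1 : f ∈ (parityGroup : Set (UnitAddCircle ≃ₜ UnitAddCircle)))
    · exact rotHalf_mem_parityGroup
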